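/- \textbf{Setting.} Let $\Xi\subseteq\mathbb R^m$ and $\Theta\subseteq\mathbb R^d$, let $0<K<\infty$, and let $h:\Theta\times\Xi\to[0,K]$ be such that $h(\theta,\cdot)$ is Borel measurable for every $\theta\in\Theta$. Let $\phi:[0,K]\to[0,\infty)$ be continuous, convex and strictly increasing, differentiable on $(0,K)$, with $M_\phi:=\sup_{t\in(0,K)}\phi'(t)<\infty$. Let $\alpha>0$, let $p_0$ be a Borel probability measure on $\Xi$, and let $\xi^n=(\xi_1,\dots,\xi_n)\in\Xi^n$ be a fixed sample. Put $$q:=\frac{\alpha}{\alpha+n}\,p_0+\frac{n}{\alpha+n}\cdot\frac1n\sum_{i=1}^n\delta_{\xi_i}$$ (so $q=p_0$ if $n=0$), and let $Q_{\xi^n}=\mathrm{DP}(\alpha+n,q)$ be the Dirichlet process posterior, that is, the law of a random probability measure $p$ on $\Xi$ such that $(p(A_1),\dots,p(A_k))\sim\mathrm{Dirichlet}\big((\alpha+n)q(A_1),\dots,(\alpha+n)q(A_k)\big)$ for every finite measurable partition $A_1,\dots,A_k$ of $\Xi$ (components with parameter $0$ being $0$). Define $$V(\theta):=\int \phi\Big(\int_\Xi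 h(\theta,x)\,p(\mathrm dx)\Big)\,Q_{\xi^n}(\mathrm dp).$$ For $T,N\ge1$ let $B_{ij}\sim\mathrm{Beta}(1,\alpha+n)$ ($1\le i\le N$, $1\le j\le T$) and $x_{ij}\sim q$ ($1\le i\le N$, $0\le j\le T$) be mutually independent, put $p_{ij}:=B_{ij}\prod_{k=1}^{j-1}(1-B_{ik})$ for $1\le j\le T$ and $p_{i0}:=\prod_{k=1}^{T}(1-B_{ik})$, and define the stick-breaking Monte Carlo approximation $$\hat V(\theta,T,N):=\frac1N\sum_{i=1}^N\phi\Big(\sum_{j=0}^Tp_{ij}\,h(\theta,x_{ij})\Big).$$ \textbf{Lemma.} Assume that $\Theta$ is bounded and has at least two points, and that for every $x\in\Xi$ the map $\theta\mapsto h(\theta,x)$ is $c(x)$-Lipschitz on $\Theta$ (for the Euclidean norm), where $c:\Xi\to[0,\infty)$ is $p_0$-integrable. Let $T\ge1$. (i) There is a constant $C_T>0$, not depending on $N$ or $\varepsilon$, such that for all $N\ge1$ and all $\varepsilon>0$ $$\sup_{\theta\in\Theta}\big|\hat V(\theta,T,N)-V(\theta)\big|\le M_\phi K\Big(\frac{\alpha+n}{\alpha+n+1}\Big)^T+\varepsilon$$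 holds with probability at least $$1-2\Big(\frac{32\,M_\phi\, C_T\,\mathrm{diam}(\Theta)\sqrt d}{\varepsilon}\Big)^d\Big[\exp\Big\{-\frac{3N\varepsilon^2}{4\phi(K)(6\phi(K)+\varepsilon)}\Big\}+\exp\Big\{-\frac{3N\varepsilon}{40\,\phi(K)}\Big\}\Big].$$ (ii) For all $N\ge1$ and all $0<\varepsilon\le 32\,M_\phi\,\bar C_T\,\mathrm{diam}(\Theta)\sqrt d$, the same statement holds with $C_T$ replaced by $\bar C_T:=\mathbb E\big[\sum_{j=0}^Tp_{1j}\,c(x_{1j})\big]$. -/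

import Mathlib

open MeasureTheory ProbabilityTheory
open scoped BigOperators NNReal ENNReal

noncomputable section

namespace SBMC

/-- The Gamma law with shape `a ≥ 0` and rate `1`, where shape `0` means the point mass at `0`. -/
def gammaLaw (a : ℝ) : Measure ℝ :=
  if a = 0 then Measure.dirac 0 else gammaMeasure a 1

/-- The Dirichlet law with parameters `a i ≥ 0`, not all zero: the law of `(G i / ∑ j, G j) i`
for independent `G i ∼ Gamma (a i, 1)`. Components with parameter `0` vanish almost surely. -/
def dirichletLaw {ι : Type*} [Fintype ι] (a : ι → ℝ) : Measure (ι → ℝ) :=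
  (Measure.pi fun i => gammaLaw (a i)).map fun g i => g i / ∑ j, g j

/-- `Q` is the law `DP(η, q)` of a Dirichlet process with concentration `η` and centering
probability measure `q`: it is a probability measure on the space of probability measures, and for
every finite measurable partition `A 1, …, A k` the vector `(p (A 1), …, p (A k))`, `p ∼ Q`, is
Dirichlet with parameters `η q (A 1), …, η q (A k)`. -/
structure IsDirichletProcess {S : Type*} [MeasurableSpace S]
    (Q : Measure (ProbabilityMeasure S)) (η : ℝ) (q : Measure S) : Prop where
  isProbabilityMeasure : IsProbabilityMeasure Q
  map_partition : ∀ (k : ℕ) (A : Fin k → Set S), (∀ i, MeasurableSet (A i)) →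
    Pairwise (fun i j => Disjoint (A i) (A j)) → (⋃ i, A i) = Set.univ →
    Q.map (fun (p : ProbabilityMeasure S) i => (p : Measure S).real (A i)) = dirichletLaw fun i => η * q.real (A i)

/-- The empirical distribution `n⁻¹ ∑ i, δ_{ξ i}`. -/
def empirical {S : Type*} [MeasurableSpace S] {n : ℕ} (ξ : Fin n → S) : Measure S :=
  (n : ℝ≥0∞)⁻¹ • ∑ i, Measure.dirac (ξ i)

/-- The predictive distribution `α / (α + n) p₀ + n / (α + n) p_ξ`. -/
def predictive {S : Type*} [MeasurableSpace S] (α : ℝ) (p₀ : Measure S) {n : ℕ}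
    (ξ : Fin n → S) : Measure S :=
  ENNReal.ofReal (α / (α + n)) • p₀ + ENNReal.ofReal (n / (α + n)) • empirical ξ

/-- `Q` is the posterior of the Dirichlet process prior `DP(α, p₀)` given the sample `ξ`. -/
def IsDPPosterior {S : Type*} [MeasurableSpace S] (Q : Measure (ProbabilityMeasure S))
    (α : ℝ) (p₀ : Measure S) {n : ℕ} (ξ : Fin n → S) : Prop :=
  IsDirichletProcess Q (α + n) (predictive α p₀ ξ)

/-- The expected risk `R_p(θ) = 𝔼_{x ∼ p} [h θ x]`. -/
def risk {E S : Type*} [MeasurableSpace S] (h : E → S → ℝ) (p : Measure S) (θ : E) : ℝ :=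
  ∫ x, h θ x ∂p

/-- The criterion `V(θ) = ∫ φ (R_p(θ)) Q(dp)`. -/
def criterion {E S : Type*} [MeasurableSpace S] (Q : Measure (ProbabilityMeasure S))
    (φ : ℝ → ℝ) (h : E → S → ℝ) (θ : E) : ℝ :=
  ∫ p : ProbabilityMeasure S, φ (risk h (p : Measure S) θ) ∂Q

/-- The stick-breaking weight `p_j = b_j ∏_{k < j} (1 - b_k)` of the `j`-th break (`j : Fin T` being
the `(j + 1)`-st break). -/
def stickWeight {T : ℕ} (b : Fin T → ℝ) (j : Fin T) : ℝ :=
  b j * ∏ k ∈ Finset.univ.filter (· < j), (1 - b k)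

/-- The mass `p_0 = ∏_k (1 - b_k)` left over after `T` breaks. -/
def stickRest {T : ℕ} (b : Fin T → ℝ) : ℝ :=
  ∏ k, (1 - b k)

/-- The draws of one Monte Carlo replication: `T` stick-breaking fractions and `T + 1` atoms. -/
abbrev Draw (S : Type*) (T : ℕ) : Type _ := (Fin T → ℝ) × (Fin (T + 1) → S)

/-- The integral `∑_{j=0}^T p_j f(x_j)` of `f` against the truncated stick-breaking measure; the
atom `x_0` carries the left-over mass, the atom `x_{j + 1}` that of the break `j : Fin T`. -/
def truncIntegral {S : Type*} {T : ℕ} (s : Draw S T) (f : S → ℝ) : ℝ :=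
  stickRest s.1 * f (s.2 0) + ∑ j : Fin T, stickWeight s.1 j * f (s.2 j.succ)

/-- The law of one replication: independent `Beta(1, η)` fractions and independent atoms from `q`,
fractions and atoms being independent. -/
def drawLaw {S : Type*} [MeasurableSpace S] (η : ℝ) (q : Measure S) (T : ℕ) :
    Measure (Draw S T) :=
  (Measure.pi fun _ => betaMeasure 1 η).prod (Measure.pi fun _ => q)

/-- The law of `N` independent replications. -/
def sampleLaw {S : Type*} [MeasurableSpace S] (η : ℝ) (q : Measure S) (T N : ℕ) :
    Measure (Fin N → Draw S T) :=
  Measure.pi fun _ => drawLaw η q T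

/-- The stick-breaking Monte Carlo approximation
`V̂(θ, T, N) = N⁻¹ ∑_{i=1}^N φ (∑_{j=0}^T p_{ij} h(θ, x_{ij}))`. -/
def sbmc {E S : Type*} {T N : ℕ} (φ : ℝ → ℝ) (h : E → S → ℝ) (s : Fin N → Draw S T)
    (θ : E) : ℝ :=
  (1 / (N : ℝ)) * ∑ i, φ (truncIntegral (s i) (h θ))

/-- `M_φ = sup_{t ∈ (0, K)} φ'(t)`. -/
def derivSup (φ : ℝ → ℝ) (K : ℝ) : ℝ := sSup (deriv φ '' Set.Ioo 0 K)

/-- The mean Lipschitz constant `∫ ∑_{j=0}^T p_j c(x_j) dP` of the truncated stick-breaking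
average, `P` being the law of one replication. -/
def meanLip {S : Type*} [MeasurableSpace S] (η : ℝ) (q : Measure S) (T : ℕ) (c : S → ℝ≥0) : ℝ :=
  ∫ s, truncIntegral s (fun x => (c x : ℝ)) ∂(drawLaw η q T)

/-- The lower bound `1 - 2 (32 M C D √d / ε)^d [exp{-3Nε²/(4Φ(6Φ+ε))} + exp{-3Nε/(40Φ)}]`, where
`Φ` is the value `φ(K)` and `D` the diameter of the parameter set. -/
def confidence (d N : ℕ) (M C D Φ ε : ℝ) : ℝ :=
  1 - 2 * (32 * M * C * D * Real.sqrt d / ε) ^ d *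
    (Real.exp (-(3 * N * ε ^ 2) / (4 * Φ * (6 * Φ + ε))) + Real.exp (-(3 * N * ε) / (40 * Φ)))

end SBMC

end

/-! The error splits into a truncation bias and a Monte Carlo fluctuation. Put η = α + n, let q be
the predictive distribution, and let R be the integral of h(θ, ·) against p ∼ Q.

Bias. In law R = B h(θ, x) + (1 - B) R, with B ∼ Beta(1, η), x ∼ q and the R on the right
independent of each other (`IsDirichletProcess.map_riskLaw`). Unfolding this T times writes R as T
stick-breaking terms plus the left-over mass times an independent copy of R. The truncated average
has h(θ, x₀) in place of that copy, so the two coupled averages differ by at most K times the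
left-over mass, whose mean is (η / (η + 1))^T; and φ is Lipschitz with constant M_φ. The equation
for R reduces, through simple functions, to one for Dirichlet vectors (`lintegral_dirichletLaw`).
That is gamma calculus: adding an Exp(1) variable to the coordinate g_i tilts the law by g_i / a_i,
and averaging over i with weights a_i / η produces the factor S / η with S = ∑ g_i. It disappears
because S has mean η and is independent of the normalized vector.

Fluctuation. A grid gives a finite net of Θ. Around each net point the summands lie in a bracket of
half-width W, the random Lipschitz constant times the mesh. The bracket ends, clipped to [0, φ(K)],
obey Hoeffding's inequality, so only the mean of W matters (`one_sub_le_measureReal_uniform`).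
Hoeffding's bound is already below the first exponential of `confidence`. -/

namespace SBMC

/-! ### Gamma laws: dilation and adding an exponential variable. -/

theorem isProbabilityMeasure_gammaLaw {a : ℝ} (ha : 0 ≤ a) : IsProbabilityMeasure (gammaLaw a) := by
  unfold gammaLaw
  split_ifs with h
  · infer_instance
  · exact isProbabilityMeasure_gammaMeasure (lt_of_le_of_ne ha (Ne.symm h)) one_pos

theorem measurable_gammaPDF (a r : ℝ) : Measurable (gammaPDF a r) :=
  (measurable_gammaPDFReal a r).ennreal_ofReal

theorem lintegral_gammaMeasure {a : ℝ} {f : ℝ → ℝ≥0∞} (hf : Measurable f) :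
    ∫⁻ x, f x ∂gammaMeasure a 1 = ∫⁻ x, gammaPDF a 1 x * f x := by
  rw [gammaMeasure, lintegral_withDensity_eq_lintegral_mul _ (measurable_gammaPDF a 1) hf]
  rfl

theorem lintegral_comp_const_mul {r : ℝ} (hr : 0 < r) {f : ℝ → ℝ≥0∞} (hf : Measurable f) :
    ∫⁻ x, f x = ENNReal.ofReal r * ∫⁻ x, f (r * x) := by
  conv_lhs => rw [← Real.smul_map_volume_mul_left hr.ne']
  rw [lintegral_smul_measure, lintegral_map hf (by fun_prop), abs_of_pos hr, smul_eq_mul]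

/-- Dilating a gamma density only produces a power of r and an exponential tilt. Shape 0 fits in,
since both factors are 1 at the atom x = 0. -/
theorem lintegral_gammaLaw_scale {a : ℝ} (ha : 0 ≤ a) {r : ℝ} (hr : 0 < r) {f : ℝ → ℝ≥0∞}
    (hf : Measurable f) :
    ∫⁻ x, f x ∂gammaLaw a =
      ∫⁻ x, f (r * x) * ENNReal.ofReal (r ^ a * Real.exp (-((r - 1) * x))) ∂gammaLaw a := by
  unfold gammaLaw
  split_ifs with h
  · simp [lintegral_dirac, h]
  have ha' : 0 < a := lt_of_le_of_ne ha (Ne.symm h)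
  rw [lintegral_gammaMeasure hf, lintegral_gammaMeasure (by fun_prop),
    lintegral_comp_const_mul hr (f := fun x => gammaPDF a 1 x * f x)
      ((measurable_gammaPDF a 1).mul hf),
    ← lintegral_const_mul _ (by have := measurable_gammaPDF a 1; fun_prop)]
  congr 1 with x
  rcases lt_or_ge x 0 with hx | hx
  · rw [gammaPDF_of_neg hx, gammaPDF_of_neg (mul_neg_of_pos_of_neg hr hx)]; simp
  rw [gammaPDF_of_nonneg hx, gammaPDF_of_nonneg (by positivity), ← mul_assoc,
    mul_comm (f _), ← ENNReal.ofReal_mul hr.le,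
    ← mul_assoc (ENNReal.ofReal (1 ^ a / Real.Gamma a * x ^ (a - 1) * Real.exp (-(1 * x)))),
    ← ENNReal.ofReal_mul (by have := Real.Gamma_pos_of_pos ha'; positivity)]
  congr 2
  rw [Real.mul_rpow hr.le hx, Real.rpow_sub_one hr.ne', show -(1 * (r * x)) = -(1 * x) +
    -((r - 1) * x) by ring, Real.exp_add]
  field_simp

/-- The factors exp(-x) and exp(x - z) cancel up to exp(-z), leaving the integral of x^(a - 1) over
(0, z). This is the convolution of Gamma(a) with Exp(1). -/
theorem lintegral_rpow_mul_exp_sub {a : ℝ} (ha : 0 < a) (z : ℝ) :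
    ∫⁻ x, gammaPDF a 1 x * (Set.Iio z).indicator (fun x => ENNReal.ofReal (Real.exp (x - z))) x =
      gammaPDF a 1 z * ENNReal.ofReal (z / a) := by
  rcases lt_or_ge z 0 with hz | hz
  · rw [gammaPDF_of_neg hz, zero_mul]
    refine (lintegral_congr fun x => ?_).trans lintegral_zero
    by_cases hx : x < z
    · rw [gammaPDF_of_neg (hx.trans hz), zero_mul]
    · simp [hx]
  have hint : IntervalIntegrable (fun x : ℝ => x ^ (a - 1)) volume 0 z :=
    intervalIntegral.intervalIntegrable_rpow' (by linarith)
  have hc : 0 ≤ Real.exp (-z) / Real.Gamma a := by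
    have := Real.Gamma_pos_of_pos ha; positivity
  have key : ∫⁻ x in Set.Ioc 0 z, ENNReal.ofReal (x ^ (a - 1)) = ENNReal.ofReal (z ^ a / a) := by
    rw [← ofReal_integral_eq_lintegral_ofReal hint.1]
    · rw [← intervalIntegral.integral_of_le hz, integral_rpow (Or.inl (by linarith))]
      simp [Real.zero_rpow ha.ne']
    · filter_upwards [ae_restrict_mem measurableSet_Ioc] with x hx
      exact Real.rpow_nonneg hx.1.le _
  calc _ = ∫⁻ x, (Set.Ioc 0 z).indicator (fun x => ENNReal.ofReal (Real.exp (-z) / Real.Gamma a) *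
        ENNReal.ofReal (x ^ (a - 1))) x := by
        refine lintegral_congr_ae ?_
        filter_upwards [Measure.ae_ne volume (0 : ℝ), Measure.ae_ne volume z] with x hx0 hxz
        by_cases hx : x ∈ Set.Ioc 0 z
        · have hx' : x < z := lt_of_le_of_ne hx.2 hxz
          rw [Set.indicator_of_mem hx, Set.indicator_of_mem (by exact hx'), gammaPDF_of_nonneg hx.1.le,
            ← ENNReal.ofReal_mul (by have := Real.Gamma_pos_of_pos ha; have := hx.1; positivity),
            ← ENNReal.ofReal_mul hc]
          congr 1
          rw [sub_eq_add_neg x z, Real.exp_add, Real.one_rpow, one_mul, Real.exp_neg x]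
          field_simp
        · rw [Set.indicator_of_notMem hx]
          rcases lt_or_ge x 0 with h | h
          · rw [gammaPDF_of_neg h, zero_mul]
          · rw [Set.indicator_of_notMem, mul_zero]
            intro h'
            exact hx ⟨lt_of_le_of_ne h (Ne.symm hx0), le_of_lt h'⟩
    _ = _ := by
        rw [lintegral_indicator measurableSet_Ioc, lintegral_const_mul _ (by fun_prop), key,
          gammaPDF_of_nonneg hz, ← ENNReal.ofReal_mul hc, ← ENNReal.ofReal_mul
            (by have := Real.Gamma_pos_of_pos ha; positivity)]
        congr 1
        rcases hz.eq_or_lt with rfl | hz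
        · simp [Real.zero_rpow ha.ne']
        rw [Real.one_rpow, one_mul, Real.rpow_sub_one hz.ne']
        field_simp

/-- Gamma(a) + Exp(1) is Gamma(a + 1), and Gamma(a + 1) has density x / a with respect to Gamma(a).
-/
theorem lintegral_gammaLaw_add_exp {a : ℝ} (ha : 0 < a) {f : ℝ → ℝ≥0∞} (hf : Measurable f) :
    ∫⁻ x, (∫⁻ y in Set.Ioi 0, ENNReal.ofReal (Real.exp (-y)) * f (x + y)) ∂gammaLaw a =
      ∫⁻ x, f x * ENNReal.ofReal (x / a) ∂gammaLaw a := by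
  have hg := measurable_gammaPDF a 1
  have h1 : ∀ x, ∫⁻ y in Set.Ioi 0, ENNReal.ofReal (Real.exp (-y)) * f (x + y) =
      ∫⁻ z, (Set.Iio z).indicator (fun x => ENNReal.ofReal (Real.exp (x - z))) x * f z := by
    intro x
    rw [← lintegral_indicator measurableSet_Ioi,
      ← lintegral_add_left_eq_self (fun z => (Set.Iio z).indicator
        (fun x => ENNReal.ofReal (Real.exp (x - z))) x * f z) x]
    congr 1 with y
    by_cases hy : 0 < y <;> simp [Set.indicator, hy]
  have hm : Measurable fun p : ℝ × ℝ =>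
      (Set.Iio p.2).indicator (fun x => ENNReal.ofReal (Real.exp (x - p.2))) p.1 := by
    have : (fun p : ℝ × ℝ =>
      (Set.Iio p.2).indicator (fun x => ENNReal.ofReal (Real.exp (x - p.2))) p.1) =
      {p : ℝ × ℝ | p.1 < p.2}.indicator fun p => ENNReal.ofReal (Real.exp (p.1 - p.2)) := by
      ext p; simp [Set.indicator]
    rw [this]
    exact Measurable.indicator (by fun_prop) (measurableSet_lt measurable_fst measurable_snd)
  simp_rw [h1]
  rw [gammaLaw, if_neg ha.ne', lintegral_gammaMeasure (by fun_prop),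
    lintegral_gammaMeasure (by fun_prop)]
  calc _ = ∫⁻ x, ∫⁻ z, gammaPDF a 1 x * ((Set.Iio z).indicator
        (fun x => ENNReal.ofReal (Real.exp (x - z))) x * f z) := by
        refine lintegral_congr fun x => ?_
        rw [lintegral_const_mul]
        have : Measurable (Prod.mk x : ℝ → ℝ × ℝ) := by fun_prop
        exact (hm.comp this).mul hf
    _ = ∫⁻ z, ∫⁻ x, gammaPDF a 1 x * ((Set.Iio z).indicator
        (fun x => ENNReal.ofReal (Real.exp (x - z))) x * f z) := by
        refine lintegral_lintegral_swap (Measurable.aemeasurable ?_)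
        exact (hg.comp measurable_fst).mul (hm.mul (hf.comp measurable_snd))
    _ = _ := by
        refine lintegral_congr fun z => ?_
        simp_rw [← mul_assoc]
        rw [lintegral_mul_const, lintegral_rpow_mul_exp_sub ha]
        · ring
        · exact hg.mul (hm.comp (by fun_prop : Measurable fun x : ℝ => (x, z)))

/-! ### The law Beta(1, η) through its odds, and product measures. -/

theorem measurable_betaPDF (a b : ℝ) : Measurable (betaPDF a b) :=
  (measurable_betaPDFReal a b).ennreal_ofReal

/-- Substitute b = t / (1 + t). The odds t later appear as y / S, with y exponential and S a sum of
gammas. -/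
theorem lintegral_betaMeasure_one {η : ℝ} (hη : 0 < η) {f : ℝ → ℝ≥0∞} (hf : Measurable f) :
    ∫⁻ b, f b ∂betaMeasure 1 η =
      ∫⁻ t in Set.Ioi 0, ENNReal.ofReal (η * (1 + t) ^ (-(η + 1))) * f (t / (1 + t)) := by
  have himage : (fun t : ℝ => t / (1 + t)) '' Set.Ioi 0 = Set.Ioo 0 1 := by
    ext b
    constructor
    · rintro ⟨t, ht, rfl⟩
      have ht : 0 < t := ht
      exact ⟨by positivity, by rw [div_lt_one (by positivity)]; linarith⟩
    · rintro ⟨h0, h1⟩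
      have h2 : 1 - b ≠ 0 := by linarith
      exact ⟨b / (1 - b), div_pos h0 (by linarith), by field_simp; ring⟩
  have hbeta : beta 1 η = 1 / η := by
    rw [beta, Real.Gamma_one, add_comm, Real.Gamma_add_one hη.ne']
    have := (Real.Gamma_pos_of_pos hη).ne'
    field_simp
  have hderiv : ∀ t ∈ Set.Ioi (0 : ℝ), HasDerivWithinAt (fun t : ℝ => t / (1 + t))
      (((1 + t) ^ 2)⁻¹) (Set.Ioi 0) t := by
    intro t ht
    have ht : 0 < t := ht
    have := ((hasDerivAt_id t).div ((hasDerivAt_id t).const_add 1) (by simp; positivity))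
    refine (this.congr_deriv ?_).hasDerivWithinAt
    simp only [id]
    field_simp
    ring
  have hinj : Set.InjOn (fun t : ℝ => t / (1 + t)) (Set.Ioi 0) := by
    intro s hs t ht hst
    have hs : 0 < s := hs
    have ht : 0 < t := ht
    have hst : s / (1 + s) = t / (1 + t) := hst
    rw [div_eq_div_iff (by positivity) (by positivity)] at hst
    linarith
  rw [betaMeasure, lintegral_withDensity_eq_lintegral_mul _ (measurable_betaPDF 1 η) hf]
  have hsupp : ∀ b, (betaPDF 1 η * f) b = (Set.Ioo 0 1).indicator (betaPDF 1 η * f) b := by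
    intro b
    by_cases hb : b ∈ Set.Ioo (0 : ℝ) 1
    · rw [Set.indicator_of_mem hb]
    · rw [Set.indicator_of_notMem hb, Pi.mul_apply, betaPDF_eq, if_neg (by simpa using hb)]
      simp
  rw [lintegral_congr hsupp, lintegral_indicator measurableSet_Ioo, ← himage,
    lintegral_image_eq_lintegral_abs_deriv_mul measurableSet_Ioi hderiv hinj]
  refine setLIntegral_congr_fun measurableSet_Ioi fun t ht => ?_
  have ht : 0 < t := ht
  have hmem : t / (1 + t) ∈ Set.Ioo (0 : ℝ) 1 := himage ▸ Set.mem_image_of_mem _ ht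
  rw [Pi.mul_apply, betaPDF_of_pos_lt_one hmem.1 hmem.2, ← mul_assoc,
    ← ENNReal.ofReal_mul (abs_nonneg _), abs_of_pos (by positivity)]
  congr 2
  rw [hbeta, show 1 - t / (1 + t) = (1 + t)⁻¹ by field_simp; ring, Real.inv_rpow (by positivity),
    ← Real.rpow_neg (by positivity), show -(η + 1) = -(η - 1) + (-2 : ℝ) by ring,
    Real.rpow_add (by positivity), Real.rpow_neg (by positivity) 2]
  norm_num
  ring

theorem lintegral_one_add_rpow {η : ℝ} (hη : 0 < η) :
    ∫⁻ t in Set.Ioi (0 : ℝ), ENNReal.ofReal (η * (1 + t) ^ (-(η + 1))) = 1 := by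
  have := isProbabilityMeasureBeta one_pos hη
  have := lintegral_betaMeasure_one hη (f := fun _ => 1) measurable_const
  simpa using this.symm

theorem lintegral_pi_prod {ι : Type*} [Fintype ι] {X : ι → Type*} [∀ i, MeasurableSpace (X i)]
    (μ : ∀ i, Measure (X i)) [∀ i, IsProbabilityMeasure (μ i)] {f : ∀ i, X i → ℝ≥0∞}
    (hf : ∀ i, Measurable (f i)) :
    ∫⁻ x, ∏ i, f i (x i) ∂Measure.pi μ = ∏ i, ∫⁻ x, f i x ∂μ i := by
  refine (lintegral_prod_eq_prod_lintegral_of_indepFun Finset.univ (fun i (x : ∀ i, X i) => f i (x i))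
    (iIndepFun_pi fun i => (hf i).aemeasurable)
    (fun i => (hf i).comp (measurable_pi_apply i))).trans ?_
  refine Finset.prod_congr rfl fun i _ => ?_
  exact (measurePreserving_eval μ i).lintegral_comp (hf i)

theorem pi_withDensity {ι : Type*} [Fintype ι] {X : ι → Type*} [∀ i, MeasurableSpace (X i)]
    (μ : ∀ i, Measure (X i)) [∀ i, IsProbabilityMeasure (μ i)] {f : ∀ i, X i → ℝ≥0∞}
    (hf : ∀ i, Measurable (f i)) [∀ i, SigmaFinite ((μ i).withDensity (f i))] :
    Measure.pi (fun i => (μ i).withDensity (f i)) =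
      (Measure.pi μ).withDensity fun x => ∏ i, f i (x i) := by
  refine Measure.pi_eq fun s hs => ?_
  rw [withDensity_apply _ (MeasurableSet.univ_pi hs),
    ← lintegral_indicator (MeasurableSet.univ_pi hs)]
  have : ∀ x, (Set.univ.pi s).indicator (fun x => ∏ i, f i (x i)) x =
      ∏ i, (s i).indicator (f i) (x i) := by
    intro x
    by_cases hx : x ∈ Set.univ.pi s
    · rw [Set.indicator_of_mem hx]
      exact Finset.prod_congr rfl fun i _ => (Set.indicator_of_mem (hx i trivial) _).symm
    · rw [Set.indicator_of_notMem hx]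
      simp only [Set.mem_univ_pi, not_forall] at hx
      obtain ⟨i, hi⟩ := hx
      exact (Finset.prod_eq_zero (Finset.mem_univ i) (Set.indicator_of_notMem hi _)).symm
  simp_rw [this]
  rw [lintegral_pi_prod μ fun i => (hf i).indicator (hs i)]
  refine Finset.prod_congr rfl fun i _ => ?_
  rw [lintegral_indicator (hs i), withDensity_apply _ (hs i)]

/-! ### The fixed point equation of the Dirichlet law. -/

section Dirichlet

variable {ι : Type*} [Fintype ι] {a : ι → ℝ}

theorem map_mul_gammaLaw {a : ℝ} (ha : 0 ≤ a) {r : ℝ} (hr : 0 < r) :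
    ((gammaLaw a).withDensity fun x => ENNReal.ofReal (r ^ a * Real.exp (-((r - 1) * x)))).map
      (fun x => r * x) = gammaLaw a := by
  refine Measure.ext_of_lintegral _ fun f hf => ?_
  rw [lintegral_map hf (by fun_prop), lintegral_withDensity_eq_lintegral_mul _ (by fun_prop)
    (by fun_prop), lintegral_gammaLaw_scale ha hr hf]
  exact lintegral_congr fun x => mul_comm _ _

theorem lintegral_pi_gammaLaw_scale (ha : ∀ i, 0 ≤ a i) {r : ℝ} (hr : 0 < r)
    {F : (ι → ℝ) → ℝ≥0∞} (hF : Measurable F) :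
    ∫⁻ g, F g ∂Measure.pi (fun i => gammaLaw (a i)) =
      ∫⁻ g, F (fun i => r * g i) *
        ENNReal.ofReal (r ^ (∑ i, a i) * Real.exp (-((r - 1) * ∑ i, g i)))
        ∂Measure.pi (fun i => gammaLaw (a i)) := by
  have := fun i => isProbabilityMeasure_gammaLaw (ha i)
  have hsf : ∀ i, SigmaFinite (((gammaLaw (a i)).withDensity fun x =>
    ENNReal.ofReal (r ^ a i * Real.exp (-((r - 1) * x)))).map (fun x => r * x)) := by
    intro i; rw [map_mul_gammaLaw (ha i) hr]; infer_instance
  have hsf' : ∀ i, SigmaFinite ((gammaLaw (a i)).withDensity fun x =>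
    ENNReal.ofReal (r ^ a i * Real.exp (-((r - 1) * x)))) :=
    fun i => SigmaFinite.withDensity_ofReal _
  conv_lhs => enter [1, 1, i]; rw [← map_mul_gammaLaw (ha i) hr]
  rw [← Measure.pi_map_pi (fun i => by fun_prop), lintegral_map hF (by fun_prop),
    pi_withDensity _ (fun i => by fun_prop), lintegral_withDensity_eq_lintegral_mul _
    (by fun_prop) (by fun_prop)]
  refine lintegral_congr fun g => ?_
  rw [Pi.mul_apply, mul_comm, ← ENNReal.ofReal_prod_of_nonneg (fun i _ => by positivity),
    Finset.prod_mul_distrib, ← Real.rpow_sum_of_pos hr, ← Real.exp_sum, Finset.sum_neg_distrib,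
    Finset.mul_sum]

theorem ae_gammaLaw_nonneg {a : ℝ} : ∀ᵐ x ∂gammaLaw a, 0 ≤ x := by
  unfold gammaLaw
  split_ifs with h
  · rw [ae_dirac_eq]; exact le_refl (0 : ℝ)
  · rw [gammaMeasure, ae_withDensity_iff (measurable_gammaPDF a 1)]
    filter_upwards with x hx
    by_contra h'
    exact hx (gammaPDF_of_neg (not_le.mp h'))

theorem ae_gammaLaw_pos {a : ℝ} (ha : 0 < a) : ∀ᵐ x ∂gammaLaw a, 0 < x := by
  rw [gammaLaw, if_neg ha.ne', gammaMeasure, ae_withDensity_iff (measurable_gammaPDF a 1)]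
  filter_upwards [Measure.ae_ne volume (0 : ℝ)] with x hx0 hx
  by_contra h'
  exact hx (gammaPDF_of_neg (lt_of_le_of_ne (not_lt.mp h') hx0))

theorem ae_pi_gammaLaw (ha : ∀ i, 0 ≤ a i) (hη : 0 < ∑ i, a i) :
    ∀ᵐ g ∂Measure.pi (fun i => gammaLaw (a i)), (∀ i, 0 ≤ g i) ∧ 0 < ∑ i, g i := by
  have := fun i => isProbabilityMeasure_gammaLaw (ha i)
  obtain ⟨j, -, hj⟩ := Finset.exists_lt_of_sum_lt (by simpa using hη : ∑ i, (0 : ℝ) < ∑ i, a i)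
  have h1 : ∀ᵐ g ∂Measure.pi (fun i => gammaLaw (a i)), ∀ i, 0 ≤ g i :=
    Filter.eventually_all.2 fun i =>
      (Measure.quasiMeasurePreserving_eval _ i).ae ae_gammaLaw_nonneg
  have h2 : ∀ᵐ g ∂Measure.pi (fun i => gammaLaw (a i)), 0 < g j :=
    (Measure.quasiMeasurePreserving_eval _ j).ae (ae_gammaLaw_pos hj)
  filter_upwards [h1, h2] with g h1 h2
  exact ⟨h1, lt_of_lt_of_le h2 (Finset.single_le_sum (fun i _ => h1 i) (Finset.mem_univ j))⟩

/-- Dilate by r = 1 + t: F does not change, the sum contributes a factor r, and the gamma laws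
contribute r^(∑ a) and the tilt exp(-t ∑ g). -/
theorem lintegral_mul_sum_mul_exp (ha : ∀ i, 0 ≤ a i) {F : (ι → ℝ) → ℝ≥0∞} (hF : Measurable F)
    (hinv : ∀ r : ℝ, 0 < r → ∀ g, F (fun i => r * g i) = F g) {t : ℝ} (ht : 0 < t) :
    ∫⁻ g, F g * ENNReal.ofReal ((∑ i, g i) * Real.exp (-(t * ∑ i, g i)))
        ∂Measure.pi (fun i => gammaLaw (a i)) =
      ENNReal.ofReal ((1 + t) ^ (-(∑ i, a i + 1))) *
        ∫⁻ g, F g * ENNReal.ofReal (∑ i, g i) ∂Measure.pi (fun i => gammaLaw (a i)) := by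
  have hr : 0 < 1 + t := by linarith
  rw [lintegral_pi_gammaLaw_scale ha hr (F := fun g => F g * ENNReal.ofReal (∑ i, g i))
    (by fun_prop), ← lintegral_const_mul _ (by fun_prop)]
  refine lintegral_congr fun g => ?_
  rw [hinv _ hr, ← Finset.mul_sum, mul_assoc, mul_left_comm, ← ENNReal.ofReal_mul' (by positivity),
    ← ENNReal.ofReal_mul (by positivity)]
  congr 2
  rw [Real.rpow_neg hr.le, Real.rpow_add_one hr.ne', add_sub_cancel_left]
  field_simp

/-- The direction of a gamma vector is uncorrelated with its sum S. Integrate the preceding identity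
over t > 0: both S exp(-tS) and η (1 + t)^(-(η + 1)) have total mass 1 in t. -/
theorem lintegral_mul_sum (ha : ∀ i, 0 ≤ a i) (hη : 0 < ∑ i, a i) {F : (ι → ℝ) → ℝ≥0∞}
    (hF : Measurable F) (hinv : ∀ r : ℝ, 0 < r → ∀ g, F (fun i => r * g i) = F g) :
    ∫⁻ g, F g * ENNReal.ofReal (∑ i, g i) ∂Measure.pi (fun i => gammaLaw (a i)) =
      ENNReal.ofReal (∑ i, a i) * ∫⁻ g, F g ∂Measure.pi (fun i => gammaLaw (a i)) := by
  have := fun i => isProbabilityMeasure_gammaLaw (ha i)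
  set η := ∑ i, a i
  set Γ := Measure.pi (fun i => gammaLaw (a i))
  have hexp : ∀ s : ℝ, 0 < s →
      ∫⁻ t in Set.Ioi (0 : ℝ), ENNReal.ofReal (s * Real.exp (-(t * s))) = 1 := by
    intro s hs
    have h1 : ∫ t in Set.Ioi (0 : ℝ), s * Real.exp (-(t * s)) = 1 := by
      rw [integral_const_mul]
      have := integral_exp_mul_Ioi (a := -s) (by linarith) 0
      simp only [neg_mul, mul_zero, Real.exp_zero, neg_div_neg_eq] at this
      simp_rw [mul_comm _ s, this]
      field_simp
    rw [← ofReal_integral_eq_lintegral_ofReal, h1, ENNReal.ofReal_one]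
    -- The integral of a nonintegrable function is 0 by convention, so the value 1 forces
    -- integrability.
    · by_contra hc
      rw [integral_undef hc] at h1
      exact zero_ne_one h1
    · exact Filter.Eventually.of_forall fun t => by positivity
  calc _ = (∫⁻ t in Set.Ioi (0 : ℝ), ENNReal.ofReal (η * (1 + t) ^ (-(η + 1)))) *
        ∫⁻ g, F g * ENNReal.ofReal (∑ i, g i) ∂Γ := by
        rw [lintegral_one_add_rpow hη, one_mul]
    _ = ∫⁻ t in Set.Ioi (0 : ℝ), ENNReal.ofReal η *
        ∫⁻ g, F g * ENNReal.ofReal ((∑ i, g i) * Real.exp (-(t * ∑ i, g i))) ∂Γ := by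
      rw [← lintegral_mul_const _ (by fun_prop)]
      refine setLIntegral_congr_fun measurableSet_Ioi fun t ht => ?_
      rw [lintegral_mul_sum_mul_exp ha hF hinv ht, ENNReal.ofReal_mul hη.le, mul_assoc]
    _ = ENNReal.ofReal η * ∫⁻ g, (∫⁻ t in Set.Ioi (0 : ℝ),
        F g * ENNReal.ofReal ((∑ i, g i) * Real.exp (-(t * ∑ i, g i)))) ∂Γ := by
      rw [lintegral_const_mul _ (by fun_prop), lintegral_lintegral_swap]
      exact Measurable.aemeasurable (by fun_prop)
    _ = _ := by
      congr 1
      refine lintegral_congr_ae ?_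
      filter_upwards [ae_pi_gammaLaw ha hη] with g hg
      rw [lintegral_const_mul _ (by fun_prop), hexp _ hg.2, mul_one]

/-- The fraction `y / (y + ∑ g)` of an exponential variable is `Beta (1, ∑ a)` and independent of
the normalized gamma vector. -/
theorem lintegral_beta_dirichletLaw (ha : ∀ i, 0 ≤ a i) (hη : 0 < ∑ i, a i)
    {H : ℝ → (ι → ℝ) → ℝ≥0∞} (hH : Measurable (Function.uncurry H)) :
    ∫⁻ b, (∫⁻ p, H b p ∂dirichletLaw a) ∂betaMeasure 1 (∑ i, a i) =
      ∫⁻ g, (∫⁻ y in Set.Ioi (0 : ℝ), ENNReal.ofReal (Real.exp (-y)) *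
        H (y / (y + ∑ i, g i)) (fun i => g i / ∑ j, g j))
        ∂Measure.pi (fun i => gammaLaw (a i)) := by
  have := fun i => isProbabilityMeasure_gammaLaw (ha i)
  set η := ∑ i, a i
  set Γ := Measure.pi (fun i => gammaLaw (a i))
  have hnorm : Measurable fun (g : ι → ℝ) i => g i / ∑ j, g j := by fun_prop
  have hdir : ∀ b, ∫⁻ p, H b p ∂dirichletLaw a = ∫⁻ g, H b (fun i => g i / ∑ j, g j) ∂Γ := by
    intro b
    rw [dirichletLaw, lintegral_map (by fun_prop) hnorm]
  have hm1 : Measurable fun p : ℝ × (ι → ℝ) => H p.1 (fun i => p.2 i / ∑ j, p.2 j) :=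
    hH.comp (measurable_fst.prodMk (hnorm.comp measurable_snd))
  have hm2 : Measurable fun p : ℝ × (ι → ℝ) =>
      H (p.1 / (1 + p.1)) (fun i => p.2 i / ∑ j, p.2 j) :=
    hm1.comp (f := fun p : ℝ × (ι → ℝ) => (p.1 / (1 + p.1), p.2)) (by fun_prop)
  have hm3 : Measurable fun p : (ι → ℝ) × ℝ => ENNReal.ofReal (Real.exp (-p.2)) *
      H (p.2 / (p.2 + ∑ i, p.1 i)) (fun i => p.1 i / ∑ j, p.1 j) := by
    refine Measurable.mul (by fun_prop) ?_
    exact hm1.comp (f := fun p : (ι → ℝ) × ℝ => (p.2 / (p.2 + ∑ i, p.1 i), p.1)) (by fun_prop)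
  simp_rw [hdir]
  rw [lintegral_betaMeasure_one hη (Measurable.lintegral_prod_right' hm1)]
  calc _ = ∫⁻ t in Set.Ioi (0 : ℝ), ∫⁻ g, H (t / (1 + t)) (fun i => g i / ∑ j, g j) *
        ENNReal.ofReal ((∑ i, g i) * Real.exp (-(t * ∑ i, g i))) ∂Γ := by
        refine setLIntegral_congr_fun measurableSet_Ioi fun t ht => ?_
        have hFm : Measurable fun g : ι → ℝ => H (t / (1 + t)) (fun i => g i / ∑ j, g j) :=
          hm2.comp (by fun_prop : Measurable fun g : ι → ℝ => (t, g))
        have hinv : ∀ r : ℝ, 0 < r → ∀ g : ι → ℝ,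
            H (t / (1 + t)) (fun i => r * g i / ∑ j, r * g j) =
              H (t / (1 + t)) (fun i => g i / ∑ j, g j) := by
          intro r hr g
          congr 1
          ext i
          rw [← Finset.mul_sum, mul_div_mul_left _ _ hr.ne']
        simp only []
        -- For fixed t the integrand depends on g only through its direction, so the beta factor can
        -- be traded for the weight S exp(-tS).
        rw [lintegral_mul_sum_mul_exp ha hFm hinv ht, lintegral_mul_sum ha hη hFm hinv,
          ← mul_assoc, ← ENNReal.ofReal_mul' hη.le, mul_comm η]
    _ = ∫⁻ g, (∫⁻ t in Set.Ioi (0 : ℝ), H (t / (1 + t)) (fun i => g i / ∑ j, g j) *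
        ENNReal.ofReal ((∑ i, g i) * Real.exp (-(t * ∑ i, g i)))) ∂Γ := by
        refine lintegral_lintegral_swap (Measurable.aemeasurable ?_)
        exact hm2.mul (by fun_prop)
    _ = _ := by
        refine lintegral_congr_ae ?_
        filter_upwards [ae_pi_gammaLaw ha hη] with g hg
        have hg := hg.2
        set S := ∑ i, g i
        symm
        -- Substitute y = S t, which turns y / (y + S) into t / (1 + t).
        rw [← lintegral_indicator measurableSet_Ioi, ← lintegral_indicator measurableSet_Ioi,
          lintegral_comp_const_mul hg, ← lintegral_const_mul]
        · refine lintegral_congr fun t => ?_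
          by_cases ht : 0 < t
          · have hst : 0 < S * t := by positivity
            rw [Set.indicator_of_mem (by exact hst), Set.indicator_of_mem (by exact ht),
              ← mul_assoc, ← ENNReal.ofReal_mul hg.le, mul_comm (H _ _)]
            congr 2
            · ring_nf
            · field_simp
              ring
          · have hst : ¬ 0 < S * t := by
              rw [not_lt] at ht ⊢
              exact mul_nonpos_of_nonneg_of_nonpos hg.le ht
            rw [Set.indicator_of_notMem (by exact hst), Set.indicator_of_notMem (by exact ht),
              mul_zero]
        · refine Measurable.comp (g := (Set.Ioi 0).indicator _) ?_ (by fun_prop)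
          refine Measurable.indicator ?_ measurableSet_Ioi
          exact hm3.comp (by fun_prop : Measurable fun y : ℝ => (g, y))
        · refine Measurable.indicator ?_ measurableSet_Ioi
          exact hm3.comp (by fun_prop : Measurable fun y : ℝ => (g, y))

/-- Adding an exponential to a single coordinate tilts the product law in that coordinate only. -/
theorem lintegral_pi_gammaLaw_add_single [DecidableEq ι] (ha : ∀ i, 0 ≤ a i) {i : ι}
    (hi : 0 < a i) {F : (ι → ℝ) → ℝ≥0∞} (hF : Measurable F) :
    ∫⁻ g, (∫⁻ y in Set.Ioi (0 : ℝ), ENNReal.ofReal (Real.exp (-y)) * F (g + Pi.single i y))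
        ∂Measure.pi (fun i => gammaLaw (a i)) =
      ∫⁻ g, F g * ENNReal.ofReal (g i / a i) ∂Measure.pi (fun i => gammaLaw (a i)) := by
  have := fun i => isProbabilityMeasure_gammaLaw (ha i)
  have hs : Measurable fun p : (ι → ℝ) × ℝ => p.1 + Pi.single i p.2 := by
    refine measurable_pi_lambda _ fun j => ?_
    rcases eq_or_ne j i with rfl | hj
    · simp only [Pi.add_apply, Pi.single_eq_same]; fun_prop
    · simp only [Pi.add_apply, Pi.single_eq_of_ne hj]; fun_prop
  have hm : Measurable fun g : ι → ℝ => ∫⁻ y in Set.Ioi (0 : ℝ),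
      ENNReal.ofReal (Real.exp (-y)) * F (g + Pi.single i y) := by
    refine Measurable.lintegral_prod_right' (ν := volume.restrict (Set.Ioi (0 : ℝ))) (f := fun p : (ι → ℝ) × ℝ =>
      ENNReal.ofReal (Real.exp (-p.2)) * F (p.1 + Pi.single i p.2)) ?_
    exact Measurable.mul (by fun_prop) (hF.comp hs)
  have hm' : Measurable fun g : ι → ℝ => F g * ENNReal.ofReal (g i / a i) := by fun_prop
  refine lintegral_eq_of_lmarginal_eq Finset.univ hm hm' ?_
  -- Integrate coordinate i innermost, so that the one-dimensional identity applies with the others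
  -- frozen.
  rw [lmarginal_erase' _ hm (Finset.mem_univ i), lmarginal_erase' _ hm' (Finset.mem_univ i)]
  congr 1
  ext g
  have hu : ∀ x y : ℝ, Function.update g i x + Pi.single i y = Function.update g i (x + y) := by
    intro x y
    ext j
    rcases eq_or_ne j i with rfl | hj
    · simp
    · simp [hj]
  simp_rw [hu, Function.update_self]
  exact lintegral_gammaLaw_add_exp hi (f := fun z => F (Function.update g i z))
    (hF.comp (measurable_update g))

/-- The distributional fixed point equation of the Dirichlet law. -/
theorem lintegral_dirichletLaw [DecidableEq ι] (ha : ∀ i, 0 ≤ a i) (hη : 0 < ∑ i, a i)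
    {F : (ι → ℝ) → ℝ≥0∞} (hF : Measurable F) :
    ∫⁻ p, F p ∂dirichletLaw a =
      ∑ i, ENNReal.ofReal (a i / ∑ j, a j) *
        ∫⁻ b, (∫⁻ p, F (fun j => b * Pi.single (M := fun _ => ℝ) i 1 j + (1 - b) * p j)
          ∂dirichletLaw a) ∂betaMeasure 1 (∑ i, a i) := by
  have := fun i => isProbabilityMeasure_gammaLaw (ha i)
  set η := ∑ i, a i with hηdef
  set Γ := Measure.pi (fun i => gammaLaw (a i)) with hΓ
  have hnorm : Measurable fun (g : ι → ℝ) i => g i / ∑ j, g j := by fun_prop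
  have hFn : Measurable fun (g : ι → ℝ) => F (fun i => g i / ∑ j, g j) := hF.comp hnorm
  have hinv : ∀ r : ℝ, 0 < r → ∀ g : ι → ℝ,
      F (fun i => r * g i / ∑ j, r * g j) = F (fun i => g i / ∑ j, g j) := by
    intro r hr g
    congr 1
    ext i
    rw [← Finset.mul_sum, mul_div_mul_left _ _ hr.ne']
  -- With B = y / (y + S), the vector B e_i + (1 - B) g / S is the normalization of g + y e_i. The
  -- tilt g_i / a_i then cancels the weight a_i.
  have hterm : ∀ i, ENNReal.ofReal (a i / η) *
        ∫⁻ b, (∫⁻ p, F (fun j => b * Pi.single (M := fun _ => ℝ) i 1 j + (1 - b) * p j)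
          ∂dirichletLaw a) ∂betaMeasure 1 η =
      ENNReal.ofReal η⁻¹ * ∫⁻ g, F (fun i => g i / ∑ j, g j) * ENNReal.ofReal (g i) ∂Γ := by
    intro i
    rcases (ha i).eq_or_lt with h0 | hi
    -- A zero parameter has no tilt, but then g_i = 0 almost surely and both sides vanish.
    · have : ∫⁻ g, F (fun i => g i / ∑ j, g j) * ENNReal.ofReal (g i) ∂Γ = 0 := by
        rw [lintegral_eq_zero_iff (by fun_prop)]
        have : ∀ᵐ x ∂gammaLaw (a i), x = 0 := by
          rw [gammaLaw, if_pos h0.symm, ae_dirac_eq]; rfl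
        filter_upwards [(Measure.quasiMeasurePreserving_eval _ i).ae this] with g hg
        rw [show g i = 0 from hg]; simp
      rw [this, ← h0]; simp
    · rw [lintegral_beta_dirichletLaw ha hη (H := fun b p =>
        F (fun j => b * Pi.single (M := fun _ => ℝ) i 1 j + (1 - b) * p j))
        (hF.comp (by fun_prop))]
      have : ∫⁻ g, (∫⁻ y in Set.Ioi (0 : ℝ), ENNReal.ofReal (Real.exp (-y)) *
          F (fun j => y / (y + ∑ i, g i) * Pi.single (M := fun _ => ℝ) i 1 j +
            (1 - y / (y + ∑ i, g i)) * (g j / ∑ i, g i))) ∂Γ =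
          ∫⁻ g, (∫⁻ y in Set.Ioi (0 : ℝ), ENNReal.ofReal (Real.exp (-y)) *
            (fun g => F (fun i => g i / ∑ j, g j)) (g + Pi.single i y)) ∂Γ := by
        refine lintegral_congr_ae ?_
        filter_upwards [ae_pi_gammaLaw ha hη] with g hg
        refine setLIntegral_congr_fun measurableSet_Ioi fun y hy => ?_
        have hg := hg.2
        have hy : 0 < y := hy
        simp only [Pi.add_apply, Finset.sum_add_distrib, Finset.sum_pi_single', Finset.mem_univ,
          if_true]
        congr 2
        ext j
        have hsing : (Pi.single i y : ι → ℝ) j = y * Pi.single (M := fun _ => ℝ) i 1 j := by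
          rcases eq_or_ne j i with rfl | hj
          · simp
          · simp [hj]
        rw [hsing, add_comm (∑ i, g i) y]
        field_simp
        ring
      rw [this, lintegral_pi_gammaLaw_add_single ha hi hFn,
        ← lintegral_const_mul _ (by fun_prop), ← lintegral_const_mul _ (by fun_prop)]
      refine lintegral_congr fun g => ?_
      rw [mul_left_comm, mul_left_comm (ENNReal.ofReal η⁻¹), ← ENNReal.ofReal_mul (by positivity),
        ← ENNReal.ofReal_mul (by positivity)]
      congr 2
      field_simp
  simp_rw [hterm]
  rw [← Finset.mul_sum, ← lintegral_finsetSum _ (fun i _ => by fun_prop)]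
  calc _ = ∫⁻ g, F (fun i => g i / ∑ j, g j) ∂Γ := by rw [dirichletLaw, lintegral_map hF hnorm]
    _ = ENNReal.ofReal η⁻¹ *
        ∫⁻ g, F (fun i => g i / ∑ j, g j) * ENNReal.ofReal (∑ i, g i) ∂Γ := by
      rw [hΓ, lintegral_mul_sum ha hη hFn hinv, ← mul_assoc, ← ENNReal.ofReal_mul (by positivity),
        inv_mul_cancel₀ hη.ne', ENNReal.ofReal_one, one_mul]
    _ = _ := by
      congr 1
      refine lintegral_congr_ae ?_
      filter_upwards [ae_pi_gammaLaw ha hη] with g hg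
      rw [ENNReal.ofReal_sum_of_nonneg (fun i _ => hg.1 i), Finset.mul_sum]

end Dirichlet

/-! ### From Dirichlet vectors to integrals against a Dirichlet process. -/

section RandomMeasure

variable {S : Type*} [MeasurableSpace S] {Q : Measure (ProbabilityMeasure S)} {η : ℝ}
  {q : Measure S}

theorem measurable_integral_probabilityMeasure {f : S → ℝ} (hf : Measurable f) :
    Measurable fun p : ProbabilityMeasure S => ∫ x, f x ∂(p : Measure S) := by
  let κ : Kernel (ProbabilityMeasure S) S := ⟨fun p => (p : Measure S), measurable_subtype_coe⟩
  exact (StronglyMeasurable.integral_kernel (κ := κ) hf.stronglyMeasurable).measurable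

theorem measurable_probabilityMeasure_real {A : Set S} (hA : MeasurableSet A) :
    Measurable fun p : ProbabilityMeasure S => (p : Measure S).real A :=
  ((Measure.measurable_coe hA).comp measurable_subtype_coe).ennreal_toReal

/-- The fixed point equation for the integral of a simple function. -/
theorem IsDirichletProcess.lintegral_simpleFunc [IsProbabilityMeasure q]
    (hQ : IsDirichletProcess Q η q) (hη : 0 < η) (f : SimpleFunc S ℝ) {ψ : ℝ → ℝ≥0∞}
    (hψ : Measurable ψ) :
    ∫⁻ p, ψ (∫ x, f x ∂(p : Measure S)) ∂Q =
      ∫⁻ x, (∫⁻ b, (∫⁻ p, ψ (b * f x + (1 - b) * ∫ x, f x ∂(p : Measure S)) ∂Q)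
        ∂betaMeasure 1 η) ∂q := by
  let e := f.range.equivFin.symm
  -- The level sets of f form the partition. Choosing index i with probability q(A i) amounts to
  -- drawing x ∼ q and reading off f x.
  let A : Fin f.range.card → Set S := fun i => f ⁻¹' {(e i : ℝ)}
  have hA : ∀ i, MeasurableSet (A i) := fun i => f.measurableSet_preimage _
  have hdisj : Pairwise fun i j => Disjoint (A i) (A j) := by
    intro i j hij
    refine Set.disjoint_left.2 fun x hi hj => hij (e.injective (Subtype.ext ?_))
    exact (show f x = e i from hi).symm.trans hj
  have hcover : (⋃ i, A i) = Set.univ := by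
    refine Set.eq_univ_of_forall fun x => Set.mem_iUnion.2 ⟨e.symm ⟨f x, f.mem_range_self x⟩, ?_⟩
    simp [A]
  have hsum : ∀ G : ℝ → ℝ≥0∞, ∑ i, G (e i) = ∑ v ∈ f.range, G v := by
    intro G
    rw [← Finset.sum_coe_sort f.range G]
    exact Equiv.sum_comp e fun v : f.range => G v
  have hsum' : ∀ G : ℝ → ℝ, ∑ i, G (e i) = ∑ v ∈ f.range, G v := by
    intro G
    rw [← Finset.sum_coe_sort f.range G]
    exact Equiv.sum_comp e fun v : f.range => G v
  have hint : ∀ p : ProbabilityMeasure S, ∫ x, f x ∂(p : Measure S) =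
      ∑ i, (p : Measure S).real (A i) * e i := by
    intro p
    rw [SimpleFunc.integral_eq_sum f (SimpleFunc.integrable_of_isFiniteMeasure f)]
    exact (hsum' fun v => (p : Measure S).real (f ⁻¹' {v}) * v).symm
  have hq : ∑ i, η * q.real (A i) = η := by
    rw [← Finset.mul_sum]
    have : ∑ i, q.real (A i) = 1 := by
      rw [← measureReal_iUnion_fintype hdisj hA, hcover, probReal_univ]
    rw [this, mul_one]
  have hmapm : Measurable fun (p : ProbabilityMeasure S) i => (p : Measure S).real (A i) :=
    measurable_pi_lambda _ fun i => measurable_probabilityMeasure_real (hA i)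
  have hd : ∀ F : (Fin f.range.card → ℝ) → ℝ≥0∞, Measurable F →
      ∫⁻ p, F (fun i => (p : Measure S).real (A i)) ∂Q =
        ∫⁻ p, F p ∂dirichletLaw fun i => η * q.real (A i) := by
    intro F hF
    rw [← hQ.map_partition _ A hA hdisj hcover, lintegral_map hF hmapm]
  have ha : ∀ i, 0 ≤ η * q.real (A i) := fun i => by positivity
  simp_rw [hint]
  rw [hd (fun r => ψ (∑ i, r i * e i)) (by fun_prop),
    lintegral_dirichletLaw ha (by rw [hq]; exact hη) (by fun_prop), hq]
  let G : ℝ → ℝ≥0∞ := fun v => ∫⁻ b, (∫⁻ p, ψ (b * v + (1 - b) *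
    ∑ i, (p : Measure S).real (A i) * e i) ∂Q) ∂betaMeasure 1 η
  have hG : ∫⁻ x, G (f x) ∂q = ∑ v ∈ f.range, G v * q (f ⁻¹' {v}) := by
    rw [← SimpleFunc.map_lintegral, ← SimpleFunc.lintegral_eq_lintegral]
    rfl
  refine Eq.trans ?_ hG.symm
  rw [← hsum fun v => G v * q (f ⁻¹' {v})]
  refine Finset.sum_congr rfl fun i _ => ?_
  rw [mul_div_cancel_left₀ _ hη.ne', measureReal_def, ENNReal.ofReal_toReal (measure_ne_top _ _),
    mul_comm]
  congr 1
  refine lintegral_congr fun b => ?_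
  rw [← hd (fun p => ψ (∑ j, (b * Pi.single (M := fun _ => ℝ) i 1 j + (1 - b) * p j) * e j))
    (by fun_prop)]
  refine lintegral_congr fun p => ?_
  congr 1
  simp only [add_mul, Finset.sum_add_distrib, mul_assoc, ← Finset.mul_sum]
  simp [Pi.single_apply]

/-- The law of the integral of `f` against a random probability measure with law `Q`. -/
noncomputable def riskLaw (Q : Measure (ProbabilityMeasure S)) (f : S → ℝ) : Measure ℝ :=
  Q.map fun p : ProbabilityMeasure S => ∫ x, f x ∂(p : Measure S)

theorem isProbabilityMeasure_riskLaw [IsProbabilityMeasure Q] {f : S → ℝ} (hf : Measurable f) :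
    IsProbabilityMeasure (riskLaw Q f) :=
  Measure.isProbabilityMeasure_map (measurable_integral_probabilityMeasure hf).aemeasurable

/-- The integral `R` of `f` against a Dirichlet process solves `R = B f(x) + (1 - B) R` in law. -/
theorem IsDirichletProcess.map_riskLaw [IsProbabilityMeasure q]
    (hQ : IsDirichletProcess Q η q) (hη : 0 < η) {f : S → ℝ} (hf : Measurable f) {K : ℝ}
    (hK : 0 ≤ K) (hfK : ∀ x, f x ∈ Set.Icc 0 K) :
    (q.prod ((betaMeasure 1 η).prod (riskLaw Q f))).map
      (fun z => z.2.1 * f z.1 + (1 - z.2.1) * z.2.2) = riskLaw Q f := by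
  have := hQ.isProbabilityMeasure
  have := isProbabilityMeasure_riskLaw (Q := Q) hf
  have := isProbabilityMeasureBeta one_pos hη
  have hR := measurable_integral_probabilityMeasure hf
  symm
  -- Bounded continuous test functions determine a finite measure, and they allow passing to the
  -- limit from simple functions.
  refine ext_of_forall_lintegral_eq_of_IsFiniteMeasure fun ψ => ?_
  have hψ : Measurable fun t => (ψ t : ℝ≥0∞) := ψ.continuous.measurable.coe_nnreal_ennreal
  obtain ⟨C, hC⟩ : ∃ C : ℝ≥0, ∀ t, (ψ t : ℝ≥0∞) ≤ C := by
    refine ⟨nndist ψ 0, fun t => ?_⟩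
    have := ψ.dist_coe_le_dist (g := 0) t
    rw [ENNReal.coe_le_coe, ← NNReal.coe_le_coe]
    simpa [NNReal.dist_eq] using this
  have hjoint : ∀ g : S → ℝ, Measurable g → Measurable fun z : S × ℝ × ProbabilityMeasure S =>
      (ψ (z.2.1 * g z.1 + (1 - z.2.1) * ∫ x, g x ∂(z.2.2 : Measure S)) : ℝ≥0∞) := by
    intro g hg
    have := (measurable_integral_probabilityMeasure hg).comp
      (measurable_snd.snd : Measurable fun z : S × ℝ × ProbabilityMeasure S => z.2.2)
    refine hψ.comp (Measurable.add (by fun_prop) (Measurable.mul (by fun_prop) this))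
  have hjoint' : ∀ g : S → ℝ, Measurable g → ∀ x, Measurable fun w : ℝ × ProbabilityMeasure S =>
      (ψ (w.1 * g x + (1 - w.1) * ∫ x, g x ∂(w.2 : Measure S)) : ℝ≥0∞) :=
    fun g hg x => (hjoint g hg).comp measurable_prodMk_left
  rw [lintegral_map hψ (by fun_prop), riskLaw, lintegral_map hψ hR,
    lintegral_prod _ (by fun_prop)]
  have hstep : ∀ x, ∫⁻ w, (ψ (w.1 * f x + (1 - w.1) * w.2) : ℝ≥0∞)
      ∂((betaMeasure 1 η).prod (Q.map fun p : ProbabilityMeasure S => ∫ x, f x ∂(p : Measure S))) =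
      ∫⁻ w, (ψ (w.1 * f x + (1 - w.1) * ∫ x, f x ∂(w.2 : Measure S)) : ℝ≥0∞)
      ∂((betaMeasure 1 η).prod Q) := by
    intro x
    have : IsProbabilityMeasure (Q.map fun p : ProbabilityMeasure S => ∫ x, f x ∂(p : Measure S)) :=
      isProbabilityMeasure_riskLaw hf
    rw [lintegral_prod _ (by fun_prop), lintegral_prod _ (hjoint' f hf x).aemeasurable]
    refine lintegral_congr fun b => ?_
    rw [lintegral_map (by fun_prop) hR]
  simp_rw [hstep]
  rw [← lintegral_prod (fun z : S × ℝ × ProbabilityMeasure S =>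
    (ψ (z.2.1 * f z.1 + (1 - z.2.1) * ∫ x, f x ∂(z.2.2 : Measure S)) : ℝ≥0∞))
    (hjoint f hf).aemeasurable]
  -- The approximants keep their values in [0, K], so the constant K dominates their integrals.
  let F := SimpleFunc.approxOn f hf (Set.Icc 0 K) 0 (Set.left_mem_Icc.2 hK)
  have hFt : ∀ x, Filter.Tendsto (fun n => F n x) Filter.atTop (nhds (f x)) := fun x =>
    SimpleFunc.tendsto_approxOn hf _ (subset_closure (hfK x))
  have hFK : ∀ n x, F n x ∈ Set.Icc 0 K := fun n x => SimpleFunc.approxOn_mem hf _ n x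
  have hFR : ∀ p : ProbabilityMeasure S, Filter.Tendsto (fun n => ∫ x, F n x ∂(p : Measure S))
      Filter.atTop (nhds (∫ x, f x ∂(p : Measure S))) := by
    intro p
    refine tendsto_integral_of_dominated_convergence (fun _ => K)
      (fun n => (F n).measurable.aestronglyMeasurable) (integrable_const K) (fun n => ?_) ?_
    · refine Filter.Eventually.of_forall fun x => ?_
      rw [Real.norm_eq_abs, abs_of_nonneg (hFK n x).1]
      exact (hFK n x).2
    · exact Filter.Eventually.of_forall hFt
  have hFm : ∀ n, Measurable fun p : ProbabilityMeasure S => ∫ x, F n x ∂(p : Measure S) :=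
    fun n => measurable_integral_probabilityMeasure (F n).measurable
  have h1 : Filter.Tendsto (fun n => ∫⁻ p, (ψ (∫ x, F n x ∂(p : Measure S)) : ℝ≥0∞) ∂Q)
      Filter.atTop (nhds (∫⁻ p, (ψ (∫ x, f x ∂(p : Measure S)) : ℝ≥0∞) ∂Q)) := by
    refine tendsto_lintegral_of_dominated_convergence (fun _ => C) (fun n => hψ.comp (hFm n))
      (fun n => Filter.Eventually.of_forall fun p => hC _) (by simp) ?_
    refine Filter.Eventually.of_forall fun p => ?_
    exact (ENNReal.continuous_coe.comp ψ.continuous).continuousAt.tendsto.comp (hFR p)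
  refine tendsto_nhds_unique h1 ?_
  have h2 : ∀ n, ∫⁻ p, (ψ (∫ x, F n x ∂(p : Measure S)) : ℝ≥0∞) ∂Q =
      ∫⁻ z : S × ℝ × ProbabilityMeasure S, (ψ (z.2.1 * F n z.1 + (1 - z.2.1) *
        ∫ x, F n x ∂(z.2.2 : Measure S)) : ℝ≥0∞) ∂q.prod ((betaMeasure 1 η).prod Q) := by
    intro n
    rw [hQ.lintegral_simpleFunc hη (F n) hψ,
      lintegral_prod _ (hjoint _ (F n).measurable).aemeasurable]
    refine lintegral_congr fun x => ?_
    rw [lintegral_prod _ (hjoint' _ (F n).measurable x).aemeasurable]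
  simp_rw [h2]
  refine tendsto_lintegral_of_dominated_convergence (fun _ => C)
    (fun n => hjoint _ (F n).measurable)
    (fun n => Filter.Eventually.of_forall fun p => hC _) (by simp) ?_
  refine Filter.Eventually.of_forall fun z => ?_
  refine (ENNReal.continuous_coe.comp ψ.continuous).continuousAt.tendsto.comp ?_
  exact ((hFt z.1).const_mul _).add ((hFR z.2.2).const_mul _)

end RandomMeasure

/-! ### Stick-breaking weights, iteration of the fixed point equation, truncation bias. -/

section StickBreaking

theorem lintegral_pi_succ {X : Type*} [MeasurableSpace X] (μ : Measure X) [SigmaFinite μ] {n : ℕ}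
    {F : (Fin (n + 1) → X) → ℝ≥0∞} (hF : Measurable F) :
    ∫⁻ y, F y ∂Measure.pi (fun _ : Fin (n + 1) => μ) =
      ∫⁻ y₀, (∫⁻ y, F (Fin.cons y₀ y) ∂Measure.pi fun _ : Fin n => μ) ∂μ := by
  have hmp := (measurePreserving_piFinSuccAbove (fun _ : Fin (n + 1) => μ) 0).symm
  rw [← hmp.lintegral_comp hF]
  refine (lintegral_prod _ (hF.comp hmp.measurable).aemeasurable).trans ?_
  simp [MeasurableEquiv.piFinSuccAbove, Fin.insertNthEquiv]

theorem stickRest_cons {T : ℕ} (b₀ : ℝ) (b : Fin T → ℝ) :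
    stickRest (Fin.cons b₀ b : Fin (T + 1) → ℝ) = (1 - b₀) * stickRest b := by
  simp [stickRest, Fin.prod_univ_succ]

theorem stickWeight_cons_zero {T : ℕ} (b₀ : ℝ) (b : Fin T → ℝ) :
    stickWeight (Fin.cons b₀ b : Fin (T + 1) → ℝ) 0 = b₀ := by
  simp [stickWeight]

/-- Self-similarity: after the first break, what remains is a stick of length 1 - b₀ broken by the
other fractions. Inductions on T rest on this. -/
theorem stickWeight_cons_succ {T : ℕ} (b₀ : ℝ) (b : Fin T → ℝ) (j : Fin T) :
    stickWeight (Fin.cons b₀ b : Fin (T + 1) → ℝ) j.succ = (1 - b₀) * stickWeight b j := by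
  simp only [stickWeight, Fin.cons_succ, Finset.prod_filter, Fin.prod_univ_succ, Fin.cons_zero,
    Fin.succ_lt_succ_iff, Fin.succ_pos, if_true]
  ring

theorem stickRest_add_sum_stickWeight {T : ℕ} (b : Fin T → ℝ) :
    stickRest b + ∑ j, stickWeight b j = 1 := by
  induction T with
  | zero => simp [stickRest]
  | succ T ih =>
    rw [← Fin.cons_self_tail b, stickRest_cons, Fin.sum_univ_succ, stickWeight_cons_zero]
    simp_rw [stickWeight_cons_succ]
    rw [← Finset.mul_sum]
    linear_combination (1 - b 0) * ih (Fin.tail b)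

theorem stickRest_nonneg {T : ℕ} {b : Fin T → ℝ} (hb : ∀ j, b j ∈ Set.Icc 0 1) :
    0 ≤ stickRest b :=
  Finset.prod_nonneg fun j _ => sub_nonneg.2 (hb j).2

theorem stickWeight_nonneg {T : ℕ} {b : Fin T → ℝ} (hb : ∀ j, b j ∈ Set.Icc 0 1) (j : Fin T) :
    0 ≤ stickWeight b j :=
  mul_nonneg (hb j).1 (Finset.prod_nonneg fun k _ => sub_nonneg.2 (hb k).2)

@[fun_prop]
theorem measurable_stickRest {T : ℕ} : Measurable (stickRest : (Fin T → ℝ) → ℝ) := by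
  unfold stickRest; fun_prop

@[fun_prop]
theorem measurable_stickWeight {T : ℕ} (j : Fin T) :
    Measurable fun b : Fin T → ℝ => stickWeight b j := by
  unfold stickWeight; fun_prop

variable {S : Type*}

theorem truncIntegral_mono {T : ℕ} {s : Draw S T} (hs : ∀ j, s.1 j ∈ Set.Icc 0 1) {f g : S → ℝ}
    (hfg : ∀ x, f x ≤ g x) : truncIntegral s f ≤ truncIntegral s g :=
  add_le_add (mul_le_mul_of_nonneg_left (hfg _) (stickRest_nonneg hs))
    (Finset.sum_le_sum fun j _ => mul_le_mul_of_nonneg_left (hfg _) (stickWeight_nonneg hs j))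

theorem truncIntegral_const {T : ℕ} (s : Draw S T) (k : ℝ) : truncIntegral s (fun _ => k) = k := by
  rw [truncIntegral, ← Finset.sum_mul, ← add_mul, stickRest_add_sum_stickWeight, one_mul]

theorem truncIntegral_add {T : ℕ} (s : Draw S T) (f g : S → ℝ) :
    truncIntegral s (fun x => f x + g x) = truncIntegral s f + truncIntegral s g := by
  simp only [truncIntegral, mul_add, Finset.sum_add_distrib]
  ring

theorem truncIntegral_mul_const {T : ℕ} (s : Draw S T) (f : S → ℝ) (k : ℝ) :
    truncIntegral s (fun x => f x * k) = truncIntegral s f * k := by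
  simp only [truncIntegral, add_mul, Finset.sum_mul, mul_assoc]

theorem truncIntegral_mem_Icc {T : ℕ} {s : Draw S T} (hs : ∀ j, s.1 j ∈ Set.Icc 0 1) {f : S → ℝ}
    {K : ℝ} (hf : ∀ x, f x ∈ Set.Icc 0 K) : truncIntegral s f ∈ Set.Icc 0 K :=
  ⟨(truncIntegral_const s 0).symm.le.trans (truncIntegral_mono hs fun x => (hf x).1),
    (truncIntegral_mono hs fun x => (hf x).2).trans (truncIntegral_const s K).le⟩

/-- With fractions in [0, 1] the truncated integral is a positive linear functional, so a pointwise
bound passes through it. -/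
theorem abs_truncIntegral_sub_le {T : ℕ} {s : Draw S T} (hs : ∀ j, s.1 j ∈ Set.Icc 0 1)
    {f g c : S → ℝ} {δ : ℝ} (hfg : ∀ x, |f x - g x| ≤ c x * δ) :
    |truncIntegral s f - truncIntegral s g| ≤ truncIntegral s c * δ := by
  rw [← truncIntegral_mul_const, abs_sub_le_iff, sub_le_iff_le_add, sub_le_iff_le_add,
    ← truncIntegral_add, ← truncIntegral_add]
  exact ⟨truncIntegral_mono hs fun x => by linarith [(abs_le.1 (hfg x)).2],
    truncIntegral_mono hs fun x => by linarith [(abs_le.1 (hfg x)).1]⟩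

variable [MeasurableSpace S]

@[fun_prop]
theorem measurable_truncIntegral {T : ℕ} {f : S → ℝ} (hf : Measurable f) :
    Measurable fun s : Draw S T => truncIntegral s f := by
  unfold truncIntegral; fun_prop

/-- Iteration of the fixed point equation over the breaks of a stick. -/
theorem lintegral_stick_fixedPoint {β ν : Measure ℝ} {q : Measure S} [IsProbabilityMeasure β]
    [IsProbabilityMeasure ν] [IsProbabilityMeasure q] {f : S → ℝ} (hf : Measurable f)
    (hν : (q.prod (β.prod ν)).map (fun z => z.2.1 * f z.1 + (1 - z.2.1) * z.2.2) = ν) (T : ℕ)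
    {ψ : ℝ → ℝ≥0∞} (hψ : Measurable ψ) :
    ∫⁻ b, (∫⁻ x, (∫⁻ r, ψ (stickRest b * r + ∑ j, stickWeight b j * f (x j)) ∂ν)
      ∂Measure.pi fun _ : Fin T => q) ∂(Measure.pi fun _ : Fin T => β) = ∫⁻ r, ψ r ∂ν := by
  induction T generalizing ψ with
  | zero => simp [stickRest]
  | succ T ih =>
    have hm3 : Measurable fun w : ((Fin (T + 1) → ℝ) × (Fin (T + 1) → S)) × ℝ =>
        ψ (stickRest w.1.1 * w.2 + ∑ j, stickWeight w.1.1 j * f (w.1.2 j)) := by fun_prop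
    have hm2 : Measurable fun w : (Fin (T + 1) → ℝ) × (Fin (T + 1) → S) =>
        ∫⁻ r, ψ (stickRest w.1 * r + ∑ j, stickWeight w.1 j * f (w.2 j)) ∂ν :=
      hm3.lintegral_prod_right'
    rw [lintegral_pi_succ β hm2.lintegral_prod_right']
    have hinner : ∀ b, ∫⁻ x, (∫⁻ r, ψ (stickRest b * r + ∑ j, stickWeight b j * f (x j)) ∂ν)
          ∂(Measure.pi fun _ : Fin (T + 1) => q) =
        ∫⁻ x₀, (∫⁻ x, (∫⁻ r, ψ (stickRest b * r + (stickWeight b 0 * f x₀ +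
          ∑ j : Fin T, stickWeight b j.succ * f (x j))) ∂ν) ∂Measure.pi fun _ : Fin T => q)
          ∂q := by
      intro b
      refine (lintegral_pi_succ q (hm2.comp (measurable_prodMk_left (x := b)))).trans ?_
      simp [Fin.sum_univ_succ]
    have hz : ∀ (b₀ x₀ r : ℝ) (b : Fin T → ℝ) (x : Fin T → S),
        (1 - b₀) * stickRest b * r + (b₀ * x₀ + ∑ j, (1 - b₀) * stickWeight b j * f (x j)) =
        b₀ * x₀ + (1 - b₀) * (stickRest b * r + ∑ j, stickWeight b j * f (x j)) := by
      intro b₀ x₀ r b x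
      rw [mul_add, Finset.mul_sum]
      simp_rw [mul_assoc]
      ring
    simp_rw [hinner, stickRest_cons, stickWeight_cons_zero, stickWeight_cons_succ]
    have hstep : ∀ b₀ : ℝ, ∫⁻ b, (∫⁻ x₀, (∫⁻ x, (∫⁻ r, ψ ((1 - b₀) * stickRest b * r +
          (b₀ * f x₀ + ∑ j, (1 - b₀) * stickWeight b j * f (x j))) ∂ν)
          ∂Measure.pi fun _ : Fin T => q) ∂q) ∂(Measure.pi fun _ : Fin T => β) =
        ∫⁻ x₀, (∫⁻ r, ψ (b₀ * f x₀ + (1 - b₀) * r) ∂ν) ∂q := by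
      intro b₀
      rw [lintegral_lintegral_swap]
      · refine lintegral_congr fun x₀ => ?_
        -- The first break acts as an affine map outside all later ones, so it is absorbed into the
        -- test function.
        rw [← ih (ψ := fun r => ψ (b₀ * f x₀ + (1 - b₀) * r)) (by fun_prop)]
        refine lintegral_congr fun b => lintegral_congr fun x => lintegral_congr fun r => ?_
        rw [hz]
      · refine Measurable.aemeasurable ?_
        have h4 : Measurable fun w : (((Fin T → ℝ) × S) × (Fin T → S)) × ℝ =>
            ψ ((1 - b₀) * stickRest w.1.1.1 * w.2 +
          (b₀ * f w.1.1.2 + ∑ j, (1 - b₀) * stickWeight w.1.1.1 j * f (w.1.2 j))) := by fun_prop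
        exact h4.lintegral_prod_right'.lintegral_prod_right'
    simp_rw [hstep]
    rw [lintegral_lintegral_swap]
    -- The later breaks have been removed; one use of the fixed point equation removes the first.
    · conv_rhs => rw [← hν, lintegral_map hψ (by fun_prop), lintegral_prod _ (by fun_prop)]
      refine lintegral_congr fun x => ?_
      rw [lintegral_prod _ (by fun_prop)]
    · have h3 : Measurable fun w : (ℝ × S) × ℝ =>
          ψ (w.1.1 * f w.1.2 + (1 - w.1.1) * w.2) := by fun_prop
      exact h3.lintegral_prod_right'.aemeasurable

theorem isProbabilityMeasure_drawLaw {η : ℝ} (hη : 0 < η) {q : Measure S} [IsProbabilityMeasure q]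
    (T : ℕ) : IsProbabilityMeasure (drawLaw η q T) := by
  have := isProbabilityMeasureBeta one_pos hη
  unfold drawLaw; infer_instance

/-- Replacing the last atom by an independent copy of the random integral gives a representation
of its law. -/
theorem map_drawLaw_prod {η : ℝ} (hη : 0 < η) {ν : Measure ℝ} {q : Measure S}
    [IsProbabilityMeasure ν] [IsProbabilityMeasure q] {f : S → ℝ} (hf : Measurable f)
    (hν : (q.prod ((betaMeasure 1 η).prod ν)).map
      (fun z => z.2.1 * f z.1 + (1 - z.2.1) * z.2.2) = ν) (T : ℕ) :
    ((drawLaw η q T).prod ν).map (fun z => stickRest z.1.1 * z.2 +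
      ∑ j : Fin T, stickWeight z.1.1 j * f (z.1.2 j.succ)) = ν := by
  have := isProbabilityMeasureBeta one_pos hη
  have := isProbabilityMeasure_drawLaw hη (q := q) T
  refine Measure.ext_of_lintegral _ fun ψ hψ => ?_
  rw [lintegral_map hψ (by fun_prop), ← lintegral_stick_fixedPoint hf hν T hψ,
    lintegral_prod _ (by fun_prop), drawLaw]
  have hm3 : Measurable fun w : ((Fin T → ℝ) × (Fin (T + 1) → S)) × ℝ =>
        ψ (stickRest w.1.1 * w.2 + ∑ j : Fin T, stickWeight w.1.1 j * f (w.1.2 j.succ)) := by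
    fun_prop
  rw [lintegral_prod _ hm3.lintegral_prod_right'.aemeasurable]
  refine lintegral_congr fun b => ?_
  -- The atom of index 0 does not occur in the integrand and integrates out with mass 1.
  refine (lintegral_pi_succ q
    (hm3.lintegral_prod_right'.comp (measurable_prodMk_left (x := b)))).trans ?_
  simp

theorem ae_betaMeasure_mem_Icc {a b : ℝ} : ∀ᵐ x ∂betaMeasure a b, x ∈ Set.Icc (0 : ℝ) 1 := by
  rw [betaMeasure, ae_withDensity_iff (measurable_betaPDF a b)]
  filter_upwards with x hx
  constructor
  · by_contra h
    exact hx (betaPDF_eq_zero_of_nonpos (le_of_not_ge h))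
  · by_contra h
    exact hx (betaPDF_eq_zero_of_one_le (le_of_not_ge h))

theorem ae_drawLaw_mem_Icc {η : ℝ} (hη : 0 < η) {q : Measure S} [IsProbabilityMeasure q] (T : ℕ) :
    ∀ᵐ s ∂drawLaw η q T, ∀ j, s.1 j ∈ Set.Icc (0 : ℝ) 1 := by
  have := isProbabilityMeasureBeta one_pos hη
  have h : ∀ᵐ b ∂Measure.pi (fun _ : Fin T => betaMeasure 1 η), ∀ j, b j ∈ Set.Icc (0 : ℝ) 1 :=
    Filter.eventually_all.2 fun j =>
      (Measure.quasiMeasurePreserving_eval _ j).ae ae_betaMeasure_mem_Icc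
  exact Measure.quasiMeasurePreserving_fst.ae h

theorem integral_one_sub_betaMeasure {η : ℝ} (hη : 0 < η) :
    ∫ b, (1 - b) ∂betaMeasure 1 η = η / (η + 1) := by
  rw [integral_eq_lintegral_of_nonneg_ae]
  · have hc : 0 ≤ η / (η + 1) := by positivity
    rw [lintegral_betaMeasure_one hη (by fun_prop), ← ENNReal.toReal_ofReal hc]
    congr 1
    -- As 1 - t / (1 + t) = (1 + t)⁻¹, the integrand is η / (η + 1) times the odds density for η +
    -- 1, which has mass 1.
    rw [← mul_one (ENNReal.ofReal (η / (η + 1))),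
      ← lintegral_one_add_rpow (by linarith : 0 < η + 1), ← lintegral_const_mul _ (by fun_prop)]
    refine setLIntegral_congr_fun measurableSet_Ioi fun t ht => ?_
    have ht : 0 < t := ht
    rw [← ENNReal.ofReal_mul (by positivity), ← ENNReal.ofReal_mul hc]
    congr 1
    rw [show -(η + 1 + 1) = -(η + 1) - 1 by ring, Real.rpow_sub_one (by positivity)]
    field_simp
    ring
  · filter_upwards [ae_betaMeasure_mem_Icc] with b hb
    exact sub_nonneg.2 hb.2
  · exact Measurable.aestronglyMeasurable (by fun_prop)

theorem integral_stickRest {η : ℝ} (hη : 0 < η) {q : Measure S} [IsProbabilityMeasure q] (T : ℕ) :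
    ∫ s, stickRest s.1 ∂drawLaw η q T = (η / (η + 1)) ^ T := by
  have := isProbabilityMeasureBeta one_pos hη
  rw [drawLaw, integral_fun_fst (fun b => stickRest b)]
  simp only [stickRest, probReal_univ, one_smul]
  rw [integral_fintype_prod_eq_prod (fun _ : Fin T => fun b : ℝ => 1 - b),
    Finset.prod_congr rfl fun _ _ => integral_one_sub_betaMeasure hη]
  simp [div_pow]

theorem integrable_stickRest {η : ℝ} (hη : 0 < η) {q : Measure S} [IsProbabilityMeasure q]
    (T : ℕ) : Integrable (fun s : Draw S T => stickRest s.1) (drawLaw η q T) := by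
  have := isProbabilityMeasure_drawLaw hη (q := q) T
  refine Integrable.of_bound (Measurable.aestronglyMeasurable (by fun_prop)) 1 ?_
  filter_upwards [ae_drawLaw_mem_Icc hη T] with s hs
  rw [Real.norm_of_nonneg (stickRest_nonneg hs), ← stickRest_add_sum_stickWeight s.1]
  exact le_add_of_nonneg_right (Finset.sum_nonneg fun j _ => stickWeight_nonneg hs j)

/-- The truncation bias. -/
theorem abs_integral_truncIntegral_sub_le {η : ℝ} (hη : 0 < η) {ν : Measure ℝ} {q : Measure S}
    [IsProbabilityMeasure ν] [IsProbabilityMeasure q] {f : S → ℝ} (hf : Measurable f)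
    (hν : (q.prod ((betaMeasure 1 η).prod ν)).map
      (fun z => z.2.1 * f z.1 + (1 - z.2.1) * z.2.2) = ν) {K : ℝ}
    (hfK : ∀ x, f x ∈ Set.Icc 0 K) (hνK : ∀ᵐ r ∂ν, r ∈ Set.Icc 0 K) {M : ℝ≥0} {φ : ℝ → ℝ}
    (hφ : LipschitzWith M φ) {Φ : ℝ} (hφb : ∀ t, φ t ∈ Set.Icc 0 Φ) (T : ℕ) :
    |∫ s, φ (truncIntegral s f) ∂drawLaw η q T - ∫ r, φ r ∂ν| ≤ M * K * (η / (η + 1)) ^ T := by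
  have := isProbabilityMeasure_drawLaw hη (q := q) T
  have hφm : Measurable φ := hφ.continuous.measurable
  have hbd : ∀ t, ‖φ t‖ ≤ Φ := fun t => by
    rw [Real.norm_of_nonneg (hφb t).1]; exact (hφb t).2
  -- Coupling: both integrals use the same draw, and the averages differ only in what carries the
  -- left-over mass, the independent copy r or f at atom 0.
  have h1 : ∫ r, φ r ∂ν = ∫ z, φ (stickRest z.1.1 * z.2 +
      ∑ j : Fin T, stickWeight z.1.1 j * f (z.1.2 j.succ)) ∂(drawLaw η q T).prod ν := by
    conv_lhs => rw [← map_drawLaw_prod hη hf hν T]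
    rw [integral_map (by fun_prop) hφm.aestronglyMeasurable]
  have h2 : ∫ s, φ (truncIntegral s f) ∂drawLaw η q T =
      ∫ z, φ (truncIntegral z.1 f) ∂(drawLaw η q T).prod ν := by
    rw [integral_fun_fst (fun s => φ (truncIntegral s f))]
    simp
  have h3 : M * K * (η / (η + 1)) ^ T =
      ∫ z, M * K * stickRest z.1.1 ∂(drawLaw η q T).prod ν := by
    rw [integral_const_mul, integral_fun_fst (fun s : Draw S T => stickRest s.1),
      integral_stickRest hη]
    simp
  rw [h1, h2, h3, ← integral_sub, ← Real.norm_eq_abs]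
  · refine norm_integral_le_of_norm_le
      (((integrable_stickRest hη T).comp_fst ν).const_mul _) ?_
    filter_upwards [Measure.quasiMeasurePreserving_fst.ae (ae_drawLaw_mem_Icc hη (q := q) T),
      Measure.quasiMeasurePreserving_snd.ae hνK] with z hz hr
    refine (hφ.norm_sub_le _ _).trans ?_
    rw [mul_assoc]
    refine mul_le_mul_of_nonneg_left ?_ M.2
    rw [truncIntegral, add_sub_add_right_eq_sub, ← mul_sub, norm_mul,
      Real.norm_of_nonneg (stickRest_nonneg hz), mul_comm]
    refine mul_le_mul_of_nonneg_right ?_ (stickRest_nonneg hz)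
    rw [Real.norm_eq_abs, abs_le]
    have := hfK (z.1.2 0)
    constructor <;> linarith [this.1, this.2, hr.1, hr.2]
  · exact Integrable.of_bound (Measurable.aestronglyMeasurable (by fun_prop)) Φ
      (Filter.Eventually.of_forall fun z => hbd _)
  · exact Integrable.of_bound (Measurable.aestronglyMeasurable (by fun_prop)) Φ
      (Filter.Eventually.of_forall fun z => hbd _)

end StickBreaking

/-! ### Hoeffding's inequality and the bracketing argument. -/

section Concentration

variable {Ω : Type*} [MeasurableSpace Ω] {P : Measure Ω} [IsProbabilityMeasure P]

/-- Hoeffding's inequality for an independent sample. -/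
theorem measureReal_sum_sub_ge_le {Y : Ω → ℝ} (hY : AEMeasurable Y P) {a b : ℝ}
    (hYb : ∀ᵐ ω ∂P, Y ω ∈ Set.Icc a b) (N : ℕ) {t : ℝ} (ht : 0 ≤ t) :
    (Measure.pi fun _ : Fin N => P).real
        {s | N * t ≤ ∑ i, (Y (s i) - ∫ ω, Y ω ∂P)} ≤
      Real.exp (-(2 * N * t ^ 2) / (b - a) ^ 2) := by
  have hsub : HasSubgaussianMGF (fun ω => Y ω - ∫ ω, Y ω ∂P) ((‖b - a‖₊ / 2) ^ 2) P :=
    hasSubgaussianMGF_of_mem_Icc hY hYb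
  have hindep : iIndepFun (fun (i : Fin N) (s : Fin N → Ω) => Y (s i) - ∫ ω, Y ω ∂P)
      (Measure.pi fun _ : Fin N => P) :=
    iIndepFun_pi (X := fun _ ω => Y ω - ∫ ω, Y ω ∂P) fun i => hsub.aemeasurable
  have hsub' : ∀ i ∈ (Finset.univ : Finset (Fin N)),
      HasSubgaussianMGF (fun s : Fin N → Ω => Y (s i) - ∫ ω, Y ω ∂P) ((‖b - a‖₊ / 2) ^ 2)
        (Measure.pi fun _ : Fin N => P) := by
    intro i _
    have hmp := measurePreserving_eval (fun _ : Fin N => P) i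
    exact HasSubgaussianMGF.of_map (Y := fun s : Fin N → Ω => s i) hmp.measurable.aemeasurable
      (by rw [show (fun s : Fin N → Ω => s i) = Function.eval i from rfl, hmp.map_eq]; exact hsub)
  have := HasSubgaussianMGF.measure_sum_ge_le_of_iIndepFun hindep hsub'
    (by positivity : 0 ≤ (N : ℝ) * t)
  refine this.trans (le_of_eq ?_)
  congr 1
  simp only [Finset.sum_const, Finset.card_univ, Fintype.card_fin, nsmul_eq_mul]
  push_cast
  rw [div_pow, Real.norm_eq_abs, sq_abs]
  rcases Nat.eq_zero_or_pos N with rfl | hN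
  · simp
  -- When a = b, both exponents are divisions by 0, hence 0.
  rcases eq_or_ne (b - a) 0 with h | h
  · simp [h]
  field_simp

/-- A uniform law of large numbers from finitely many brackets `Y (π θ) ± W`. -/
theorem one_sub_le_measureReal_uniform {E : Type*} {Θ : Set E} {Y : E → Ω → ℝ} {Φ : ℝ}
    (hYm : ∀ θ ∈ Θ, AEMeasurable (Y θ) P)
    (hYb : ∀ θ ∈ Θ, ∀ ω, Y θ ω ∈ Set.Icc 0 Φ) {J : Finset E} (hJ : ∀ k ∈ J, k ∈ Θ)
    {π : E → E} (hπ : ∀ θ ∈ Θ, π θ ∈ J) {W : Ω → ℝ} (hW : Integrable W P)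
    (hπW : ∀ᵐ ω ∂P, ∀ θ ∈ Θ, |Y θ ω - Y (π θ) ω| ≤ W ω) {ε : ℝ} (hε : 0 < ε)
    (hWε : ∫ ω, W ω ∂P ≤ 3 * ε / 8) {N : ℕ} (hN : 1 ≤ N) :
    1 - J.card * (2 * Real.exp (-(N * ε ^ 2) / (8 * Φ ^ 2))) ≤
      (Measure.pi fun _ : Fin N => P).real
        {s | ∀ θ ∈ Θ, |1 / (N : ℝ) * ∑ i, Y θ (s i) - ∫ ω, Y θ ω ∂P| ≤ ε} := by
  set μ := Measure.pi fun _ : Fin N => P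
  set G := {s : Fin N → Ω | ∀ θ ∈ Θ, |1 / (N : ℝ) * ∑ i, Y θ (s i) - ∫ ω, Y θ ω ∂P| ≤ ε}
  have hN' : (0 : ℝ) < N := by exact_mod_cast hN
  -- W may be unbounded, so the brackets are clipped to [0, Φ], where Y lives anyway. The lower one
  -- is negated, so that both need only an upper tail bound.
  let u : E → Ω → ℝ := fun k ω => max 0 (min Φ (Y k ω + W ω))
  let l : E → Ω → ℝ := fun k ω => -(max 0 (min Φ (Y k ω - W ω)))
  have hum : ∀ k ∈ Θ, AEMeasurable (u k) P := fun k hk =>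
    (aemeasurable_const.max (aemeasurable_const.min ((hYm k hk).add hW.aemeasurable)))
  have hlm : ∀ k ∈ Θ, AEMeasurable (l k) P := fun k hk =>
    (aemeasurable_const.max (aemeasurable_const.min ((hYm k hk).sub hW.aemeasurable))).neg
  have hub : ∀ k ∈ Θ, ∀ ω, u k ω ∈ Set.Icc 0 Φ := fun k hk ω =>
    ⟨le_max_left _ _, max_le ((hYb k hk ω).1.trans (hYb k hk ω).2) (min_le_left _ _)⟩
  have hlb : ∀ k ∈ Θ, ∀ ω, l k ω ∈ Set.Icc (-Φ) 0 := fun k hk ω =>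
    ⟨neg_le_neg (max_le ((hYb k hk ω).1.trans (hYb k hk ω).2) (min_le_left _ _)),
      neg_nonpos.2 (le_max_left _ _)⟩
  have hYi : ∀ θ ∈ Θ, Integrable (Y θ) P := fun θ hθ =>
    Integrable.of_bound (hYm θ hθ).aestronglyMeasurable Φ (Filter.Eventually.of_forall fun ω => by
      rw [Real.norm_of_nonneg (hYb θ hθ ω).1]; exact (hYb θ hθ ω).2)
  have hui : ∀ θ ∈ Θ, Integrable (u θ) P := fun θ hθ =>
    Integrable.of_bound (hum θ hθ).aestronglyMeasurable Φ (Filter.Eventually.of_forall fun ω => by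
      rw [Real.norm_of_nonneg (hub θ hθ ω).1]; exact (hub θ hθ ω).2)
  have hli : ∀ θ ∈ Θ, Integrable (l θ) P := fun θ hθ =>
    Integrable.of_bound (hlm θ hθ).aestronglyMeasurable Φ (Filter.Eventually.of_forall fun ω => by
      rw [Real.norm_of_nonpos (hlb θ hθ ω).2]; linarith [(hlb θ hθ ω).1])
  let A : E → Set (Fin N → Ω) := fun k => {s | N * (ε / 4) ≤ ∑ i, (u k (s i) - ∫ ω, u k ω ∂P)}
  let B : E → Set (Fin N → Ω) := fun k => {s | N * (ε / 4) ≤ ∑ i, (l k (s i) - ∫ ω, l k ω ∂P)}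
  have hA : ∀ k ∈ J, μ.real (A k) ≤ Real.exp (-(N * ε ^ 2) / (8 * Φ ^ 2)) := fun k hk => by
    refine (measureReal_sum_sub_ge_le (hum k (hJ k hk))
      (Filter.Eventually.of_forall (hub k (hJ k hk))) N (by positivity)).trans (le_of_eq ?_)
    congr 1
    rw [sub_zero, show 2 * (N : ℝ) * (ε / 4) ^ 2 = N * ε ^ 2 / 8 by ring, ← neg_div, div_div]
  have hB : ∀ k ∈ J, μ.real (B k) ≤ Real.exp (-(N * ε ^ 2) / (8 * Φ ^ 2)) := fun k hk => by
    refine (measureReal_sum_sub_ge_le (hlm k (hJ k hk))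
      (Filter.Eventually.of_forall (hlb k (hJ k hk))) N (by positivity)).trans (le_of_eq ?_)
    congr 1
    rw [zero_sub, neg_neg, show 2 * (N : ℝ) * (ε / 4) ^ 2 = N * ε ^ 2 / 8 by ring, ← neg_div,
      div_div]
  have hnice : ∀ᵐ s ∂μ, ∀ i, ∀ θ ∈ Θ, |Y θ (s i) - Y (π θ) (s i)| ≤ W (s i) :=
    Filter.eventually_all.2 fun i => (Measure.quasiMeasurePreserving_eval (fun _ : Fin N => P) i).ae hπW
  have hmean : ∀ θ ∈ Θ, ∫ ω, u (π θ) ω ∂P ≤ ∫ ω, Y θ ω ∂P + 2 * ∫ ω, W ω ∂P ∧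
      ∫ ω, l (π θ) ω ∂P ≤ -∫ ω, Y θ ω ∂P + 2 * ∫ ω, W ω ∂P := by
    intro θ hθ
    have hk := hJ _ (hπ θ hθ)
    rw [← integral_const_mul, ← integral_add (hYi θ hθ) (hW.const_mul 2), ← integral_neg,
      ← integral_add (f := fun ω => -Y θ ω) (hYi θ hθ).neg (hW.const_mul 2)]
    constructor
    · refine integral_mono_ae (hui _ hk) ((hYi θ hθ).add (hW.const_mul 2)) ?_
      filter_upwards [hπW] with ω hω
      have h1 := abs_le.1 (hω θ hθ)
      have h2 := (abs_nonneg _).trans (hω θ hθ)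
      exact max_le (by linarith [(hYb θ hθ ω).1]) ((min_le_right _ _).trans (by linarith [h1.1]))
    · refine integral_mono_ae (hli _ hk) ((hYi θ hθ).neg.add (hW.const_mul 2)) ?_
      filter_upwards [hπW] with ω hω
      have h1 := abs_le.1 (hω θ hθ)
      have h2 := (abs_nonneg _).trans (hω θ hθ)
      have h3 : Y θ ω - 2 * W ω ≤ min Φ (Y (π θ) ω - W ω) :=
        le_min (by linarith [(hYb θ hθ ω).2]) (by linarith [h1.2])
      have h4 := h3.trans (le_max_right 0 _)
      change -(max 0 (min Φ (Y (π θ) ω - W ω))) ≤ -(Y θ ω) + 2 * W ω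
      linarith
  -- G is an intersection over possibly uncountably many θ and need not be measurable. Covering the
  -- space by G and the bad events requires only subadditivity of the outer measure.
  have hcover : (Set.univ : Set (Fin N → Ω)) ≤ᵐ[μ] (G ∪ ⋃ k ∈ J, (A k ∪ B k) : Set (Fin N → Ω)) := by
    filter_upwards [hnice] with s hs _
    by_contra hcon
    have hcon : s ∉ G ∪ ⋃ k ∈ J, (A k ∪ B k) := hcon
    simp only [Set.mem_union, Set.mem_iUnion, not_or, not_exists] at hcon
    obtain ⟨hsG, hsJ⟩ := hcon
    refine hsG fun θ hθ => ?_
    have hk := hπ θ hθ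
    obtain ⟨hsA, hsB⟩ := hsJ _ hk
    have hsA : ∑ i, (u (π θ) (s i) - ∫ ω, u (π θ) ω ∂P) < N * (ε / 4) := not_le.1 hsA
    have hsB : ∑ i, (l (π θ) (s i) - ∫ ω, l (π θ) ω ∂P) < N * (ε / 4) := not_le.1 hsB
    rw [Finset.sum_sub_distrib, Finset.sum_const, Finset.card_univ, Fintype.card_fin,
      nsmul_eq_mul] at hsA hsB
    have h1 : ∑ i, Y θ (s i) ≤ ∑ i, u (π θ) (s i) := Finset.sum_le_sum fun i _ => by
      have h1 := abs_le.1 (hs i θ hθ)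
      exact (le_min (hYb θ hθ (s i)).2 (by linarith [h1.2])).trans (le_max_right _ _)
    have h2 : -∑ i, Y θ (s i) ≤ ∑ i, l (π θ) (s i) := by
      rw [← Finset.sum_neg_distrib]
      refine Finset.sum_le_sum fun i _ => ?_
      have h1 := abs_le.1 (hs i θ hθ)
      exact neg_le_neg (max_le (hYb θ hθ (s i)).1
        ((min_le_right _ _).trans (by linarith [h1.1])))
    obtain ⟨h3, h4⟩ := hmean θ hθ
    have h5 := mul_le_mul_of_nonneg_left h3 hN'.le
    have h6 := mul_le_mul_of_nonneg_left h4 hN'.le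
    have h7 := mul_le_mul_of_nonneg_left hWε hN'.le
    rw [show 1 / (N : ℝ) * ∑ i, Y θ (s i) - ∫ ω, Y θ ω ∂P =
      (∑ i, Y θ (s i) - N * ∫ ω, Y θ ω ∂P) / N by field_simp, abs_div, abs_of_pos hN',
      div_le_iff₀ hN', abs_le]
    -- Error budget: ε / 4 from the deviation of a bracket end, and 2 · (3ε / 8) from the distance
    -- between its mean and that of Y.
    constructor <;> nlinarith
  have hone : 1 ≤ μ.real (G ∪ ⋃ k ∈ J, (A k ∪ B k)) := by
    have := ENNReal.toReal_mono (measure_ne_top _ _) (measure_mono_ae hcover)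
    rwa [measure_univ, ENNReal.toReal_one] at this
  have hbad : μ.real (⋃ k ∈ J, (A k ∪ B k)) ≤
      J.card * (2 * Real.exp (-(N * ε ^ 2) / (8 * Φ ^ 2))) := by
    refine (measureReal_biUnion_finset_le J _).trans ?_
    rw [← nsmul_eq_mul]
    refine Finset.sum_le_card_nsmul J _ _ fun k hk => ?_
    refine (measureReal_union_le _ _).trans ?_
    linarith [hA k hk, hB k hk]
  linarith [measureReal_union_le (μ := μ) G (⋃ k ∈ J, (A k ∪ B k))]

end Concentration

/-! ### A grid net of a bounded set. -/

section Covering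

/-- Points of `[0, D]` with the same index in the subdivision into `m` intervals. -/
theorem abs_sub_le_of_floor_eq {m : ℕ} (hm : 0 < m) {D x y : ℝ} (hD : 0 < D)
    (hx : x ∈ Set.Icc 0 D) (hy : y ∈ Set.Icc 0 D)
    (h : min ⌊m * x / D⌋₊ (m - 1) = min ⌊m * y / D⌋₊ (m - 1)) : |x - y| ≤ D / m := by
  have hm' : (0 : ℝ) < m := by exact_mod_cast hm
  have hx0 : 0 ≤ m * x / D := by have := hx.1; positivity
  have hy0 : 0 ≤ m * y / D := by have := hy.1; positivity
  suffices |m * x / D - m * y / D| ≤ 1 by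
    rw [← sub_div, ← mul_sub, abs_div, abs_mul, abs_of_pos hm', abs_of_pos hD,
      div_le_one hD] at this
    rw [le_div_iff₀ hm']
    linarith
  have hxm : m * x / D ≤ m := by rw [div_le_iff₀ hD]; exact mul_le_mul_of_nonneg_left hx.2 hm'.le
  have hym : m * y / D ≤ m := by rw [div_le_iff₀ hD]; exact mul_le_mul_of_nonneg_left hy.2 hm'.le
  have hx1 := Nat.floor_le hx0
  have hy1 := Nat.floor_le hy0
  have hx2 := Nat.lt_floor_add_one (m * x / D)
  have hy2 := Nat.lt_floor_add_one (m * y / D)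
  have hcast : ((m - 1 : ℕ) : ℝ) = m - 1 := by rw [Nat.cast_sub hm, Nat.cast_one]
  rw [abs_le]
  rcases eq_or_ne ⌊m * x / D⌋₊ ⌊m * y / D⌋₊ with heq | hne
  · rw [heq] at hx1 hx2
    constructor <;> linarith
  -- Different floors with equal capped indices occur only at the right end, where both rescaled
  -- points lie in [m - 1, m].
  · have h1 : m - 1 ≤ ⌊m * x / D⌋₊ := by omega
    have h2 : m - 1 ≤ ⌊m * y / D⌋₊ := by omega
    have h1 : (m : ℝ) - 1 ≤ ⌊m * x / D⌋₊ := by rw [← hcast]; exact_mod_cast h1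
    have h2 : (m : ℝ) - 1 ≤ ⌊m * y / D⌋₊ := by rw [← hcast]; exact_mod_cast h2
    constructor <;> linarith

/-- A bounded set with diameter `D` in `ℝ^d` has a net of `m ^ d` points at scale `√d D / m`. -/
theorem exists_finset_net {d : ℕ} {Θ : Set (EuclideanSpace ℝ (Fin d))}
    (hb : Bornology.IsBounded Θ) (hΘ : Θ.Nontrivial) {m : ℕ} (hm : 0 < m) :
    ∃ (J : Finset (EuclideanSpace ℝ (Fin d)))
      (π : EuclideanSpace ℝ (Fin d) → EuclideanSpace ℝ (Fin d)), J.card ≤ m ^ d ∧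
      (∀ k ∈ J, k ∈ Θ) ∧ (∀ θ ∈ Θ, π θ ∈ J) ∧
      ∀ θ ∈ Θ, dist θ (π θ) ≤ Real.sqrt d * Metric.diam Θ / m := by
  classical
  set D := Metric.diam Θ
  have hD : 0 < D := Metric.diam_pos hΘ hb
  obtain ⟨θ₀, hθ₀⟩ := hΘ.nonempty
  have hcoord : ∀ θ ∈ Θ, ∀ θ' ∈ Θ, ∀ i, |θ i - θ' i| ≤ D := fun θ hθ θ' hθ' i => by
    have h1 := PiLp.norm_apply_le (θ - θ') i
    rw [PiLp.sub_apply, Real.norm_eq_abs, ← dist_eq_norm] at h1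
    exact h1.trans (Metric.dist_le_diam_of_mem hb hθ hθ')
  let a : Fin d → ℝ := fun i => sInf ((fun θ : EuclideanSpace ℝ (Fin d) => θ i) '' Θ)
  have hbelow : ∀ i, BddBelow ((fun θ : EuclideanSpace ℝ (Fin d) => θ i) '' Θ) := fun i =>
    ⟨θ₀ i - D, by rintro _ ⟨θ, hθ, rfl⟩; linarith [(abs_le.1 (hcoord θ hθ θ₀ hθ₀ i)).1]⟩
  have ha : ∀ θ ∈ Θ, ∀ i, θ i - a i ∈ Set.Icc 0 D := fun θ hθ i => by
    refine ⟨sub_nonneg.2 (csInf_le (hbelow i) ⟨θ, hθ, rfl⟩), ?_⟩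
    have : θ i - D ≤ a i := le_csInf ⟨θ₀ i, θ₀, hθ₀, rfl⟩ (by
      rintro _ ⟨θ', hθ', rfl⟩; linarith [(abs_le.1 (hcoord θ hθ θ' hθ' i)).2])
    linarith
  -- Cell index of θ. The cap at m - 1 puts the right end point of a side into the last interval.
  let g : EuclideanSpace ℝ (Fin d) → Fin d → Fin m := fun θ i =>
    ⟨min ⌊m * (θ i - a i) / D⌋₊ (m - 1), by omega⟩
  -- One point of Θ per occupied cell, because the Lipschitz bound holds only on Θ; the value θ₀ on
  -- empty cells is arbitrary.
  let rep : (Fin d → Fin m) → EuclideanSpace ℝ (Fin d) := fun f =>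
    if h : ∃ θ ∈ Θ, g θ = f then h.choose else θ₀
  have hrep : ∀ f, rep f ∈ Θ := fun f => by
    by_cases h : ∃ θ ∈ Θ, g θ = f
    · simp only [rep, dif_pos h]; exact h.choose_spec.1
    · simp only [rep, dif_neg h]; exact hθ₀
  have hgrep : ∀ θ ∈ Θ, g (rep (g θ)) = g θ := fun θ hθ => by
    have h : ∃ θ' ∈ Θ, g θ' = g θ := ⟨θ, hθ, rfl⟩
    simp only [rep, dif_pos h]; exact h.choose_spec.2
  refine ⟨Finset.univ.image rep, fun θ => rep (g θ), ?_, ?_, ?_, ?_⟩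
  · refine Finset.card_image_le.trans (le_of_eq ?_)
    simp
  · intro k hk
    obtain ⟨f, -, rfl⟩ := Finset.mem_image.1 hk
    exact hrep f
  · exact fun θ _ => Finset.mem_image_of_mem _ (Finset.mem_univ _)
  · intro θ hθ
    have hi : ∀ i, |θ i - rep (g θ) i| ≤ D / m := fun i => by
      have h1 := abs_sub_le_of_floor_eq hm hD (ha θ hθ i) (ha _ (hrep (g θ)) i)
        (congrArg Fin.val (congrFun (hgrep θ hθ) i)).symm
      rwa [sub_sub_sub_cancel_right] at h1
    rw [EuclideanSpace.dist_eq]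
    calc _ ≤ Real.sqrt (∑ _i : Fin d, (D / m) ^ 2) := by
          refine Real.sqrt_le_sqrt (Finset.sum_le_sum fun i _ => ?_)
          rw [Real.dist_eq]
          exact pow_le_pow_left₀ (abs_nonneg _) (hi i) 2
      _ = _ := by
          rw [Finset.sum_const, Finset.card_univ, Fintype.card_fin, nsmul_eq_mul,
            Real.sqrt_mul (Nat.cast_nonneg _), Real.sqrt_sq (by positivity), mul_div_assoc]

end Covering

/-! ### The predictive distribution. -/

section Predictive

variable {S : Type*} [MeasurableSpace S] {α : ℝ} {p₀ : Measure S} {n : ℕ}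

theorem isProbabilityMeasure_predictive (hα : 0 < α) [IsProbabilityMeasure p₀] (ξ : Fin n → S) :
    IsProbabilityMeasure (predictive α p₀ ξ) := by
  constructor
  rcases Nat.eq_zero_or_pos n with rfl | hn
  · simp [predictive, empirical, hα.ne']
  have hn' : (0 : ℝ) < n := by exact_mod_cast hn
  simp only [predictive, empirical, Measure.coe_add, Measure.coe_smul, Pi.add_apply,
    Pi.smul_apply, measure_univ, smul_eq_mul, mul_one, Measure.coe_finsetSum, Finset.sum_apply,
    Finset.sum_const, Finset.card_univ, Fintype.card_fin, nsmul_eq_mul]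
  rw [ENNReal.inv_mul_cancel (by exact_mod_cast hn.ne') (ENNReal.natCast_ne_top n), mul_one,
    ← ENNReal.ofReal_add (by positivity) (by positivity), ← add_div, div_self (by positivity),
    ENNReal.ofReal_one]

theorem integrable_predictive [MeasurableSingletonClass S] {f : S → ℝ} (hf : Integrable f p₀)
    (ξ : Fin n → S) : Integrable f (predictive α p₀ ξ) := by
  refine (hf.smul_measure ENNReal.ofReal_ne_top).add_measure ?_
  refine Integrable.smul_measure ?_ ENNReal.ofReal_ne_top
  -- For n = 0 the scalar n⁻¹ is ∞, but it multiplies the zero measure.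
  rcases Nat.eq_zero_or_pos n with rfl | hn
  · simp [empirical]
  refine Integrable.smul_measure ?_ (ENNReal.inv_ne_top.2 (by exact_mod_cast hn.ne'))
  exact integrable_finsetSum_measure.2 fun i _ => integrable_dirac (by simp)

end Predictive

/-! ### Extension of φ to the line, and the criterion as an integral over the law of the risk. -/

section Risk

variable {K : ℝ} {φ : ℝ → ℝ}

theorem deriv_le_derivSup (φ_deriv : BddAbove (deriv φ '' Set.Ioo 0 K)) {t : ℝ}
    (ht : t ∈ Set.Ioo 0 K) : deriv φ t ≤ derivSup φ K :=
  le_csSup φ_deriv ⟨t, ht, rfl⟩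

theorem derivSup_pos (hK : 0 < K) (φ_cont : ContinuousOn φ (Set.Icc 0 K))
    (φ_mono : StrictMonoOn φ (Set.Icc 0 K)) (φ_diff : DifferentiableOn ℝ φ (Set.Ioo 0 K))
    (φ_deriv : BddAbove (deriv φ '' Set.Ioo 0 K)) : 0 < derivSup φ K := by
  obtain ⟨t, ht, htd⟩ := exists_deriv_eq_slope φ hK φ_cont φ_diff
  refine lt_of_lt_of_le ?_ (deriv_le_derivSup φ_deriv ht)
  rw [htd]
  exact div_pos (sub_pos.2 (φ_mono ⟨le_rfl, hK.le⟩ ⟨hK.le, le_rfl⟩ hK)) (by linarith)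

/-- The extension of `φ` from `[0, K]` to the line by constants. -/
def clamp (φ : ℝ → ℝ) (K t : ℝ) : ℝ := φ (max 0 (min K t))

theorem clamp_eq {t : ℝ} (ht : t ∈ Set.Icc 0 K) : clamp φ K t = φ t := by
  rw [clamp, min_eq_right ht.2, max_eq_right ht.1]

theorem clamp_mem_Icc (hK : 0 < K) (φ_nonneg : ∀ t ∈ Set.Icc 0 K, 0 ≤ φ t)
    (φ_mono : StrictMonoOn φ (Set.Icc 0 K)) (t : ℝ) : clamp φ K t ∈ Set.Icc 0 (φ K) := by
  have hmem : max 0 (min K t) ∈ Set.Icc 0 K := ⟨le_max_left _ _, max_le hK.le (min_le_left _ _)⟩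
  exact ⟨φ_nonneg _ hmem, φ_mono.monotoneOn hmem ⟨hK.le, le_rfl⟩ hmem.2⟩

/-- The mean value theorem bounds the slopes of φ on [0, K] by M_φ, and the projection of the line
onto [0, K] is 1-Lipschitz. -/
theorem lipschitzWith_clamp (hK : 0 < K) (φ_cont : ContinuousOn φ (Set.Icc 0 K))
    (φ_mono : StrictMonoOn φ (Set.Icc 0 K)) (φ_diff : DifferentiableOn ℝ φ (Set.Ioo 0 K))
    (φ_deriv : BddAbove (deriv φ '' Set.Ioo 0 K)) :
    LipschitzWith (derivSup φ K).toNNReal (clamp φ K) := by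
  have hM := derivSup_pos hK φ_cont φ_mono φ_diff φ_deriv
  have hle : ∀ x ∈ Set.Icc 0 K, ∀ y ∈ Set.Icc 0 K, x ≤ y →
      |φ x - φ y| ≤ derivSup φ K * |x - y| := by
    intro x hx y hy hxy
    rcases hxy.eq_or_lt with rfl | hlt
    · simp
    obtain ⟨t, ht, htd⟩ := exists_deriv_eq_slope φ hlt
      (φ_cont.mono (Set.Icc_subset_Icc hx.1 hy.2)) (φ_diff.mono (Set.Ioo_subset_Ioo hx.1 hy.2))
    have := deriv_le_derivSup φ_deriv (Set.Ioo_subset_Ioo hx.1 hy.2 ht)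
    rw [htd, div_le_iff₀ (sub_pos.2 hlt)] at this
    rw [abs_sub_comm, abs_sub_comm x, abs_of_pos (sub_pos.2 (φ_mono hx hy hlt)),
      abs_of_pos (sub_pos.2 hlt)]
    exact this
  have hφ : LipschitzOnWith (derivSup φ K).toNNReal φ (Set.Icc 0 K) := by
    refine LipschitzOnWith.of_dist_le_mul fun x hx y hy => ?_
    rw [Real.coe_toNNReal _ hM.le, Real.dist_eq, Real.dist_eq]
    rcases le_total x y with h | h
    · exact hle x hx y hy h
    · rw [abs_sub_comm, abs_sub_comm x]
      exact hle y hy x hx h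
  have hp : LipschitzWith 1 fun t : ℝ => max 0 (min K t) :=
    (LipschitzWith.id.const_min K).const_max 0
  have := hφ.comp (hp.lipschitzOnWith (s := Set.univ)) fun t _ =>
    (⟨le_max_left _ _, max_le hK.le (min_le_left _ _)⟩ : max 0 (min K t) ∈ Set.Icc 0 K)
  rw [mul_one, lipschitzOnWith_univ] at this
  exact this

theorem sbmc_eq_clamp {E S : Type*} {T N : ℕ} {h : E → S → ℝ} {θ : E}
    (hfK : ∀ x, h θ x ∈ Set.Icc 0 K) {s : Fin N → Draw S T}
    (hs : ∀ i j, (s i).1 j ∈ Set.Icc (0 : ℝ) 1) :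
    sbmc φ h s θ = 1 / (N : ℝ) * ∑ i, clamp φ K (truncIntegral (s i) (h θ)) := by
  rw [sbmc]
  congr 1
  exact Finset.sum_congr rfl fun i _ => (clamp_eq (truncIntegral_mem_Icc (hs i) hfK)).symm

variable {S : Type*} [MeasurableSpace S]

theorem integral_mem_Icc {f : S → ℝ} (hf : Measurable f) (hfK : ∀ x, f x ∈ Set.Icc 0 K)
    (p : Measure S) [IsProbabilityMeasure p] : ∫ x, f x ∂p ∈ Set.Icc 0 K := by
  refine ⟨integral_nonneg fun x => (hfK x).1, ?_⟩
  have hi : Integrable f p := Integrable.of_bound hf.aestronglyMeasurable K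
    (Filter.Eventually.of_forall fun x => by
      rw [Real.norm_of_nonneg (hfK x).1]; exact (hfK x).2)
  simpa using integral_mono hi (integrable_const K) fun x => (hfK x).2

theorem criterion_eq_integral_riskLaw {E : Type*} {Q : Measure (ProbabilityMeasure S)}
    {h : E → S → ℝ} {θ : E} (hf : Measurable (h θ)) (hfK : ∀ x, h θ x ∈ Set.Icc 0 K)
    (hφ : Continuous (clamp φ K)) :
    criterion Q φ h θ = ∫ r, clamp φ K r ∂riskLaw Q (h θ) := by
  rw [riskLaw, integral_map (measurable_integral_probabilityMeasure hf).aemeasurable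
    hφ.aestronglyMeasurable]
  exact integral_congr_ae (Filter.Eventually.of_forall fun p =>
    (clamp_eq (integral_mem_Icc hf hfK (p : Measure S))).symm)

theorem ae_riskLaw_mem_Icc {Q : Measure (ProbabilityMeasure S)} {f : S → ℝ} (hf : Measurable f)
    (hfK : ∀ x, f x ∈ Set.Icc 0 K) : ∀ᵐ r ∂riskLaw Q f, r ∈ Set.Icc 0 K := by
  refine (ae_map_iff (measurable_integral_probabilityMeasure hf).aemeasurable
    measurableSet_Icc).2 ?_
  exact Filter.Eventually.of_forall fun p => integral_mem_Icc hf hfK (p : Measure S)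

/-- Each term is a weight bounded by 1 times an integrable function of an independent atom. -/
theorem integrable_truncIntegral {η : ℝ} (hη : 0 < η) {q : Measure S} [IsProbabilityMeasure q]
    (T : ℕ) {f : S → ℝ} (hf : Integrable f q) :
    Integrable (fun s : Draw S T => truncIntegral s f) (drawLaw η q T) := by
  have := isProbabilityMeasureBeta one_pos hη
  have hb : ∀ᵐ b ∂Measure.pi (fun _ : Fin T => betaMeasure 1 η), ∀ j, b j ∈ Set.Icc (0 : ℝ) 1 :=
    Filter.eventually_all.2 fun j =>
      (Measure.quasiMeasurePreserving_eval _ j).ae ae_betaMeasure_mem_Icc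
  have hfj : ∀ j, Integrable (fun x : Fin (T + 1) → S => f (x j)) (Measure.pi fun _ => q) :=
    fun j => (measurePreserving_eval (fun _ => q) j).integrable_comp_of_integrable hf
  refine Integrable.add ?_ (integrable_finsetSum _ fun j _ => ?_)
  · refine Integrable.mul_prod ?_ (hfj 0)
    refine Integrable.of_bound (Measurable.aestronglyMeasurable (by fun_prop)) 1 ?_
    filter_upwards [hb] with b hb
    rw [Real.norm_of_nonneg (stickRest_nonneg hb), ← stickRest_add_sum_stickWeight b]
    exact le_add_of_nonneg_right (Finset.sum_nonneg fun j _ => stickWeight_nonneg hb j)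
  · refine Integrable.mul_prod (f := fun b => stickWeight b j) ?_ (hfj j.succ)
    refine Integrable.of_bound (Measurable.aestronglyMeasurable (by fun_prop)) 1 ?_
    filter_upwards [hb] with b hb
    rw [Real.norm_of_nonneg (stickWeight_nonneg hb j), ← stickRest_add_sum_stickWeight b]
    exact (Finset.single_le_sum (fun j _ => stickWeight_nonneg hb j) (Finset.mem_univ j)).trans
      (le_add_of_nonneg_left (stickRest_nonneg hb))

end Risk

/-! ### The uniform bound for a general constant C. -/

section Uniform

theorem confidence_le_one {d N : ℕ} {M C D Φ ε : ℝ} (hM : 0 ≤ M) (hC : 0 ≤ C) (hD : 0 ≤ D)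
    (hε : 0 ≤ ε) : confidence d N M C D Φ ε ≤ 1 :=
  sub_le_self _ (by positivity)

/-- Since 4Φ(6Φ + ε) ≥ 24Φ², the Hoeffding term is at most the first exponential; the second one is
slack. -/
theorem confidence_le {d N : ℕ} {M C D Φ ε : ℝ} (hΦ : 0 < Φ) (hε : 0 < ε) {k m : ℕ}
    (hk : k ≤ m ^ d) (hm : (m : ℝ) ≤ 32 * M * C * D * Real.sqrt d / ε) :
    confidence d N M C D Φ ε ≤ 1 - k * (2 * Real.exp (-(N * ε ^ 2) / (8 * Φ ^ 2))) := by
  have hk' : (k : ℝ) ≤ (32 * M * C * D * Real.sqrt d / ε) ^ d :=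
    (by exact_mod_cast hk : (k : ℝ) ≤ (m : ℝ) ^ d).trans
      (pow_le_pow_left₀ (Nat.cast_nonneg m) hm d)
  have hexp : Real.exp (-(N * ε ^ 2) / (8 * Φ ^ 2)) ≤
      Real.exp (-(3 * N * ε ^ 2) / (4 * Φ * (6 * Φ + ε))) := by
    rw [Real.exp_le_exp, neg_div, neg_div, neg_le_neg_iff,
      div_le_div_iff₀ (by positivity) (by positivity)]
    have : (0 : ℝ) ≤ N * ε ^ 2 * (Φ * ε) := by positivity
    nlinarith
  have h1 : (k : ℝ) * (2 * Real.exp (-(N * ε ^ 2) / (8 * Φ ^ 2))) ≤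
      (32 * M * C * D * Real.sqrt d / ε) ^ d *
        (2 * (Real.exp (-(3 * N * ε ^ 2) / (4 * Φ * (6 * Φ + ε))) +
          Real.exp (-(3 * N * ε) / (40 * Φ)))) := by
    have h2 : 0 ≤ Real.exp (-(3 * N * ε) / (40 * Φ)) := (Real.exp_pos _).le
    refine mul_le_mul hk' (by linarith) (by positivity) ((Nat.cast_nonneg k).trans hk')
  rw [confidence]
  linarith

/-- The uniform bound with any constant `C` above the mean Lipschitz constant. -/
theorem confidence_le_sampleLaw {S : Type*} [MeasurableSpace S] {d : ℕ}
    {Θ : Set (EuclideanSpace ℝ (Fin d))} {K : ℝ} (hK : 0 < K)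
    {h : EuclideanSpace ℝ (Fin d) → S → ℝ} (h_meas : ∀ θ ∈ Θ, Measurable (h θ))
    (h_range : ∀ θ ∈ Θ, ∀ x, h θ x ∈ Set.Icc 0 K) {φ : ℝ → ℝ}
    (φ_nonneg : ∀ t ∈ Set.Icc 0 K, 0 ≤ φ t) (φ_cont : ContinuousOn φ (Set.Icc 0 K))
    (φ_mono : StrictMonoOn φ (Set.Icc 0 K)) (φ_diff : DifferentiableOn ℝ φ (Set.Ioo 0 K))
    (φ_deriv : BddAbove (deriv φ '' Set.Ioo 0 K)) {η : ℝ} (hη : 0 < η) {q : Measure S}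
    [IsProbabilityMeasure q] {Q : Measure (ProbabilityMeasure S)}
    (hQ : IsDirichletProcess Q η q) (Θ_bdd : Bornology.IsBounded Θ) (Θ_nontrivial : Θ.Nontrivial)
    {c : S → ℝ≥0} (h_lip : ∀ x, LipschitzOnWith (c x) (fun θ => h θ x) Θ)
    (c_int : Integrable (fun x => (c x : ℝ)) q) {T : ℕ} {C : ℝ} (hC : meanLip η q T c ≤ C)
    {N : ℕ} (hN : 1 ≤ N) {ε : ℝ} (hε : 0 < ε)
    (hεC : ε ≤ 32 * derivSup φ K * C * Metric.diam Θ * Real.sqrt d ∨ φ K ≤ ε ∧ 0 ≤ C) :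
    confidence d N (derivSup φ K) C (Metric.diam Θ) (φ K) ε ≤
      (sampleLaw η q T N).real {s | ∀ θ ∈ Θ, |sbmc φ h s θ - criterion Q φ h θ| ≤
        derivSup φ K * K * (η / (η + 1)) ^ T + ε} := by
  have := hQ.isProbabilityMeasure
  have hP := isProbabilityMeasure_drawLaw hη (q := q) T
  have hM := derivSup_pos hK φ_cont φ_mono φ_diff φ_deriv
  have hlip := lipschitzWith_clamp hK φ_cont φ_mono φ_diff φ_deriv
  have hrange := clamp_mem_Icc hK φ_nonneg φ_mono
  have hΦ : 0 < φ K :=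
    (φ_nonneg 0 ⟨le_rfl, hK.le⟩).trans_lt (φ_mono ⟨le_rfl, hK.le⟩ ⟨hK.le, le_rfl⟩ hK)
  set M := derivSup φ K
  set D := Metric.diam Θ
  have hD : 0 < D := Metric.diam_pos Θ_nontrivial Θ_bdd
  let Y : EuclideanSpace ℝ (Fin d) → Draw S T → ℝ := fun θ s => clamp φ K (truncIntegral s (h θ))
  have hYm : ∀ θ ∈ Θ, Measurable (Y θ) := fun θ hθ => by
    have := h_meas θ hθ
    exact hlip.continuous.measurable.comp (by fun_prop)
  have hYb : ∀ θ ∈ Θ, ∀ s, Y θ s ∈ Set.Icc 0 (φ K) := fun θ _ s => hrange _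
  have hb : ∀ᵐ s ∂sampleLaw η q T N, ∀ i j, (s i).1 j ∈ Set.Icc (0 : ℝ) 1 :=
    Filter.eventually_all.2 fun i =>
      (Measure.quasiMeasurePreserving_eval (fun _ : Fin N => drawLaw η q T) i).ae
        (ae_drawLaw_mem_Icc hη T)
  have hbias : ∀ θ ∈ Θ, |∫ s, Y θ s ∂drawLaw η q T - criterion Q φ h θ| ≤
      M * K * (η / (η + 1)) ^ T := fun θ hθ => by
    have := isProbabilityMeasure_riskLaw (Q := Q) (h_meas θ hθ)
    rw [criterion_eq_integral_riskLaw (h_meas θ hθ) (h_range θ hθ) hlip.continuous]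
    have := abs_integral_truncIntegral_sub_le hη (h_meas θ hθ)
      (hQ.map_riskLaw hη (h_meas θ hθ) hK.le (h_range θ hθ)) (h_range θ hθ)
      (ae_riskLaw_mem_Icc (h_meas θ hθ) (h_range θ hθ)) hlip hrange T
    rwa [Real.coe_toNNReal _ hM.le] at this
  have hmono : (sampleLaw η q T N).real
        {s | ∀ θ ∈ Θ, |1 / (N : ℝ) * ∑ i, Y θ (s i) - ∫ s, Y θ s ∂drawLaw η q T| ≤ ε} ≤
      (sampleLaw η q T N).real {s | ∀ θ ∈ Θ, |sbmc φ h s θ - criterion Q φ h θ| ≤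
        M * K * (η / (η + 1)) ^ T + ε} := by
    have : IsProbabilityMeasure (sampleLaw η q T N) := by unfold sampleLaw; infer_instance
    refine ENNReal.toReal_mono (measure_ne_top _ _) (measure_mono_ae ?_)
    filter_upwards [hb] with s hs hsG θ hθ
    rw [sbmc_eq_clamp (h_range θ hθ) hs]
    have h1 := hsG θ hθ
    have h2 := hbias θ hθ
    exact (abs_sub_le _ (∫ s, Y θ s ∂drawLaw η q T) _).trans (by linarith)
  refine le_trans ?_ hmono
  rcases hεC with hεC | ⟨hεΦ, hC0⟩
  · set X := 32 * M * C * D * Real.sqrt d / ε with hX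
    have hX1 : 1 ≤ X := by rwa [hX, le_div_iff₀ hε, one_mul]
    -- The mesh r = √d D / m gives M C r = Xε / (32 m) ≤ 12ε / 32 = 3ε / 8, as the brackets require.
    -- Rounding up keeps m ≤ X because X ≥ 1.
    set m := ⌈X / 12⌉₊ with hm
    have hm0 : 0 < m := Nat.ceil_pos.2 (by linarith)
    have hm0' : (0 : ℝ) < m := by exact_mod_cast hm0
    have hmX : (m : ℝ) ≤ X := by
      rcases le_total X 12 with h12 | h12
      · have : m ≤ 1 := Nat.ceil_le.2 (by rw [Nat.cast_one]; linarith)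
        exact (by exact_mod_cast this : (m : ℝ) ≤ 1).trans hX1
      · have := Nat.ceil_lt_add_one (by linarith : 0 ≤ X / 12)
        linarith
    have hXm : X / 12 ≤ m := Nat.le_ceil _
    obtain ⟨J, π, hJc, hJ, hπ, hdist⟩ := exists_finset_net Θ_bdd Θ_nontrivial hm0
    set r := Real.sqrt d * D / m with hr
    have hr0 : 0 ≤ r := by positivity
    refine (confidence_le hΦ hε hJc hmX).trans ?_
    let W : Draw S T → ℝ := fun s => M * (truncIntegral s (fun x => (c x : ℝ)) * r)
    have hW : Integrable W (drawLaw η q T) :=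
      ((integrable_truncIntegral hη T c_int).mul_const r).const_mul M
    refine one_sub_le_measureReal_uniform (fun θ hθ => (hYm θ hθ).aemeasurable) hYb hJ hπ hW ?_ hε
      ?_ hN
    · filter_upwards [ae_drawLaw_mem_Icc hη (q := q) T] with s hs θ hθ
      have h1 := hlip.dist_le_mul (truncIntegral s (h θ)) (truncIntegral s (h (π θ)))
      rw [Real.dist_eq, Real.dist_eq, Real.coe_toNNReal _ hM.le] at h1
      refine h1.trans (mul_le_mul_of_nonneg_left ?_ hM.le)
      refine abs_truncIntegral_sub_le hs fun x => ?_
      have h2 := (h_lip x).dist_le_mul θ hθ _ (hJ _ (hπ θ hθ))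
      rw [Real.dist_eq] at h2
      exact h2.trans (mul_le_mul_of_nonneg_left (hdist θ hθ) (c x).2)
    · have h1 : ∫ s, W s ∂drawLaw η q T = M * (meanLip η q T c * r) := by
        rw [integral_const_mul, integral_mul_const, meanLip]
      rw [h1]
      have h2 : M * (meanLip η q T c * r) ≤ M * (C * r) := by gcongr
      refine h2.trans ?_
      rw [hX, div_div, div_le_iff₀ (by positivity)] at hXm
      rw [hr, mul_div_assoc', mul_div_assoc', div_le_div_iff₀ hm0' (by norm_num)]
      nlinarith
  -- For ε ≥ φ(K) the event is certain: sample mean and expectation both lie in [0, φ(K)].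
  · refine (confidence_le_one hM.le hC0 hD.le hε.le).trans ?_
    have : IsProbabilityMeasure (sampleLaw η q T N) := by unfold sampleLaw; infer_instance
    refine le_of_eq ?_
    symm
    convert probReal_univ (μ := sampleLaw η q T N)
    refine Set.eq_univ_of_forall fun s θ hθ => ?_
    have hN' : (0 : ℝ) < N := by exact_mod_cast hN
    have h1 : 1 / (N : ℝ) * ∑ i, Y θ (s i) ∈ Set.Icc 0 (φ K) := by
      refine ⟨mul_nonneg (by positivity) (Finset.sum_nonneg fun i _ => (hYb θ hθ _).1), ?_⟩
      rw [one_div, inv_mul_le_iff₀ hN']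
      have := Finset.sum_le_card_nsmul Finset.univ (fun i => Y θ (s i)) (φ K)
        fun i _ => (hYb θ hθ _).2
      simpa using this
    have h2 := integral_mem_Icc (hYm θ hθ) (hYb θ hθ) (drawLaw η q T)
    rw [abs_le]
    constructor <;> linarith [h1.1, h1.2, h2.1, h2.2]

end Uniform

end SBMC

/-! ### The two statements of the lemma. -/

theorem mainTheorem6 {m d n : ℕ}
    (Ξ : Set (EuclideanSpace ℝ (Fin m))) (Θ : Set (EuclideanSpace ℝ (Fin d)))
    (K : ℝ) (hK : 0 < K)
    (h : EuclideanSpace ℝ (Fin d) → Ξ → ℝ)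
    (h_meas : ∀ θ ∈ Θ, Measurable (h θ))
    (h_range : ∀ θ ∈ Θ, ∀ x, h θ x ∈ Set.Icc 0 K)
    (φ : ℝ → ℝ)
    (φ_nonneg : ∀ t ∈ Set.Icc 0 K, 0 ≤ φ t)
    (φ_cont : ContinuousOn φ (Set.Icc 0 K))
    (φ_convex : ConvexOn ℝ (Set.Icc 0 K) φ)
    (φ_mono : StrictMonoOn φ (Set.Icc 0 K))
    (φ_diff : DifferentiableOn ℝ φ (Set.Ioo 0 K))
    (φ_deriv : BddAbove (deriv φ '' Set.Ioo 0 K))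
    (α : ℝ) (hα : 0 < α) (p₀ : Measure Ξ) [IsProbabilityMeasure p₀] (ξ : Fin n → Ξ)
    (Q : Measure (ProbabilityMeasure Ξ)) (hQ : SBMC.IsDPPosterior Q α p₀ ξ)
    (Θ_bdd : Bornology.IsBounded Θ) (Θ_nontrivial : Θ.Nontrivial)
    (c : Ξ → ℝ≥0) (h_lip : ∀ x, LipschitzOnWith (c x) (fun θ => h θ x) Θ)
    (c_int : Integrable (fun x => (c x : ℝ)) p₀)
    (T : ℕ) (hT : 1 ≤ T) :
    (∃ C : ℝ, 0 < C ∧ ∀ N : ℕ, 1 ≤ N → ∀ ε : ℝ, 0 < ε →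
      SBMC.confidence d N (SBMC.derivSup φ K) C (Metric.diam Θ) (φ K) ε ≤
        (SBMC.sampleLaw (α + n) (SBMC.predictive α p₀ ξ) T N).real
          {s | ∀ θ ∈ Θ, |SBMC.sbmc φ h s θ - SBMC.criterion Q φ h θ| ≤
            SBMC.derivSup φ K * K * ((α + n) / (α + n + 1)) ^ T + ε}) ∧
    (∀ N : ℕ, 1 ≤ N → ∀ ε : ℝ, 0 < ε →
      ε ≤ 32 * SBMC.derivSup φ K * SBMC.meanLip (α + n) (SBMC.predictive α p₀ ξ) T c *
        Metric.diam Θ * Real.sqrt d →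
      SBMC.confidence d N (SBMC.derivSup φ K)
          (SBMC.meanLip (α + n) (SBMC.predictive α p₀ ξ) T c) (Metric.diam Θ) (φ K) ε ≤
        (SBMC.sampleLaw (α + n) (SBMC.predictive α p₀ ξ) T N).real
          {s | ∀ θ ∈ Θ, |SBMC.sbmc φ h s θ - SBMC.criterion Q φ h θ| ≤
            SBMC.derivSup φ K * K * ((α + n) / (α + n + 1)) ^ T + ε}) := by
  have hη : 0 < α + n := by positivity
  have := SBMC.isProbabilityMeasure_predictive hα ξ (p₀ := p₀)
  have hc := SBMC.integrable_predictive (α := α) c_int ξ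
  have hM := SBMC.derivSup_pos hK φ_cont φ_mono φ_diff φ_deriv
  have hD : 0 < Metric.diam Θ := Metric.diam_pos Θ_nontrivial Θ_bdd
  -- Two distinct points exclude dimension 0, so √d can be divided by.
  have hd : 0 < d := by
    rcases Nat.eq_zero_or_pos d with rfl | hd
    · exact absurd (Set.subsingleton_of_subsingleton (s := Θ)) Θ_nontrivial.not_subsingleton
    · exact hd
  have hd' : 0 < Real.sqrt d := Real.sqrt_pos.2 (by exact_mod_cast hd)
  have hΦ : 0 < φ K :=
    (φ_nonneg 0 ⟨le_rfl, hK.le⟩).trans_lt (φ_mono ⟨le_rfl, hK.le⟩ ⟨hK.le, le_rfl⟩ hK)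
  constructor
  · set k := 32 * SBMC.derivSup φ K * Metric.diam Θ * Real.sqrt d with hk
    have hk0 : 0 < k := by positivity
    set L := SBMC.meanLip (α + n) (SBMC.predictive α p₀ ξ) T c
    have hC0 : 0 < max L (φ K / k) := lt_max_of_lt_right (by positivity)
    -- The term φ(K) / k makes k C ≥ φ(K). Hence every ε is either at least φ(K), where the event is
    -- certain, or at most k C, where the net argument applies.
    refine ⟨max L (φ K / k), hC0, fun N hN ε hε => ?_⟩
    refine SBMC.confidence_le_sampleLaw hK h_meas h_range φ_nonneg φ_cont φ_mono φ_diff φ_deriv hη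
      hQ Θ_bdd Θ_nontrivial h_lip hc (le_max_left _ _) hN hε ?_
    rcases le_total (φ K) ε with h1 | h1
    · exact Or.inr ⟨h1, hC0.le⟩
    · refine Or.inl (h1.trans ?_)
      have h2 := (div_le_iff₀ hk0).1 (le_max_right L (φ K / k))
      linarith [h2, mul_comm (max L (φ K / k)) k, show 32 * SBMC.derivSup φ K * max L (φ K / k) *
        Metric.diam Θ * Real.sqrt d = max L (φ K / k) * k by rw [hk]; ring]
  · intro N hN ε hε hεC
    exact SBMC.confidence_le_sampleLaw hK h_meas h_range φ_nonneg φ_cont φ_mono φ_diff φ_deriv hη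
      hQ Θ_bdd Θ_nontrivial h_lip hc le_rfl hN hε (Or.inl hεC)
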